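/- **Setting.** Let $z=(z_1,\dots,z_d)$ be a random vector, $F_i$ the cdf of $z_i$, and $u_z=(F_1(z_1),\dots,F_d(z_d))$; assume that the law $P_{u_z}$ of $u_z$ has a pdf. For a distribution $P$ on $[0,1]^d$ with pdf $p$ let $h(P)=-\int p\log p\in[-\infty,0]$, and put $h(u_z)=h(P_{u_z})$. Let $\mathcal D_d$ be the set of probability distributions supported on $[0,1]^d$ that have a pdf, and $\mathcal C_d\subset\mathcal D_d$ the set of those whose one-dimensional marginals are uniform on $[0,1]$. Let $\psi_m:[0,1]^d\to\mathbb R^{q_m}$ $(m=0,1,2,\dots)$ be bounded measurable functions and, for $k\ge 1$, $$\phi_m^k(u)=(1,u_1,\dots,u_1^k,\dots,u_d,\dots,u_d^k,\psi_m(u)).$$ For $\beta\in\mathbb R^{q_m}$ put $\alpha^k(\beta)=(1,\tfrac12,\dots,\tfrac1{1+k},\dots,\tfrac12,\dots,\tfrac1{1+k},\beta)$ and (with $\sup\emptyset=-\infty$) $$h_{\rm AM}(\phi_m^k,\beta)=\sup\{h(P):P\in\mathcal D_d,\ E_P[\phi_m^k(u)]=\alpha^k(\beta)\},\qquad h_{\rm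 M}(\psi_m,\beta)=\sup\{h(P):P\in\mathcal C_d,\ E_P[\psi_m(u)]=\beta\}.$$ Let $\beta_m=E_{P_{u_z}}[\psi_m(u)]$ and, for every $m$, let $\hat\beta_{m,n}$ be a consistent estimator of $\beta_m$, i.e. $\hat\beta_{m,n}\to\beta_m$ in probability as $n\to\infty$. We say that $\phi_m^k$ is *non-degenerate* if no non-trivial linear combination of its coordinates vanishes $P_{u_z}$-almost surely, and that $(\phi_m^k)_m$ is a *universal approximator* if for every continuous $f$ on $[0,1]^d$ the uniform distance from $f$ to the linear span of the coordinates of $\phi_m^k$ tends to $0$ as $m\to\infty$. All limits are in $[-\infty,\infty)$, and random ones are in probability. **Theorem.** (A) Let $m$ be such that $\phi_m^k$ is non-degenerate for every $k\ge1$. Then $h_{\rm AM}(\phi_m^k,\hat\beta_{m,n})\to h_{\rm M}(\psi_m,\beta_m)$ as $n\to\infty$ and then $k\to\infty$; that is, $h_{\rm AM}(\phi_m^k,\hat\beta_{m,n})\to h_{\rm AM}(\phi_m^k,\beta_m)$ as $n\to\infty$ for every $k\ge1$, and $h_{\rm AM}(\phi_m^k,\beta_m)\to h_{\rm M}(\psi_m,\beta_m)$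 as $k\to\infty$. Moreover there are $N(k)\in\mathbb N$ such that $h_{\rm AM}(\phi_m^k,\hat\beta_{m,n})\to h_{\rm M}(\psi_m,\beta_m)$ as $k,n\to\infty$ jointly with $n\ge N(k)$; and if $\beta_m$ is an interior point of $\{E_Q[\psi_m(u)]:Q\in\mathcal C_d,\ h(Q)>-\infty\}$, then the same holds as $k,n\to\infty$ jointly without restriction. (B) Let $k\ge1$ be such that $\phi_m^k$ is non-degenerate for every $m$ and $(\phi_m^k)_m$ is a universal approximator. Then $h_{\rm AM}(\phi_m^k,\hat\beta_{m,n})\to h(u_z)$ as $n\to\infty$ and then $m\to\infty$; that is, $h_{\rm AM}(\phi_m^k,\hat\beta_{m,n})\to h_{\rm AM}(\phi_m^k,\beta_m)$ as $n\to\infty$ for every $m$, and $h_{\rm AM}(\phi_m^k,\beta_m)\to h(u_z)$ as $m\to\infty$. Moreover there are $N(m)\in\mathbb N$ such that $h_{\rm AM}(\phi_m^k,\hat\beta_{m,n})\to h(u_z)$ as $m,n\to\infty$ jointly with $n\ge N(m)$. -/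

import Mathlib

open MeasureTheory ProbabilityTheory Filter Topology
open scoped ENNReal

noncomputable section

namespace MaxEntCopula

/-- The unit cube `[0,1]^d`. -/
def cube (d : ℕ) : Set (Fin d → ℝ) := Set.Icc 0 1

/-- Differential entropy `h(P) = -∫ p log p` of a distribution with pdf `p = dP/du`, as an extended
real: the integral of the positive part of `-p log p` minus the integral of its negative part.
(For distributions supported on the unit cube the first integral is finite, so that `h(P)` is
well defined, possibly `-∞`.) -/
def diffEntropy {d : ℕ} (P : Measure (Fin d → ℝ)) : EReal :=
  ((∫⁻ u, ENNReal.ofReal (Real.negMulLog (P.rnDeriv volume u).toReal) : ℝ≥0∞) : EReal) -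
    ((∫⁻ u, ENNReal.ofReal (-Real.negMulLog (P.rnDeriv volume u).toReal) : ℝ≥0∞) : EReal)

/-- `D_d`: the distributions with a pdf that are supported on the unit cube. -/
structure IsCubeLaw {d : ℕ} (P : Measure (Fin d → ℝ)) : Prop where
  prob : IsProbabilityMeasure P
  hasPDF : P ≪ volume
  supp : P (cube d)ᶜ = 0

/-- `C_d`: the copula distributions with a pdf. -/
structure IsCopulaLaw {d : ℕ} (P : Measure (Fin d → ℝ)) : Prop extends IsCubeLaw P where
  uniform_marginals : ∀ i, P.map (fun u => u i) = volume.restrict (Set.Icc (0 : ℝ) 1)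

/-- Coordinatewise expectation `E_P[φ(u)]` of a vector-valued statistic. -/
def expect {d : ℕ} {ι : Type*} (P : Measure (Fin d → ℝ)) (φ : (Fin d → ℝ) → ι → ℝ) : ι → ℝ :=
  fun j => ∫ u, φ u j ∂P

/-- Value of the maximum-entropy problem over the copula distributions `P` with pdf such that
`E_P[φ(u)] = α`; it is `-∞` if the problem is infeasible. -/
def mind {d : ℕ} {ι : Type*} (φ : (Fin d → ℝ) → ι → ℝ) (α : ι → ℝ) : EReal :=
  sSup {h | ∃ P : Measure (Fin d → ℝ), IsCopulaLaw P ∧ expect P φ = α ∧ h = diffEntropy P}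

/-- Value of the relaxed maximum-entropy problem, over all distributions `P` with pdf that are
supported on the cube and such that `E_P[φ(u)] = α`; it is `-∞` if the problem is infeasible. -/
def amind {d : ℕ} {ι : Type*} (φ : (Fin d → ℝ) → ι → ℝ) (α : ι → ℝ) : EReal :=
  sSup {h | ∃ P : Measure (Fin d → ℝ), IsCubeLaw P ∧ expect P φ = α ∧ h = diffEntropy P}

/-- Index set of the coordinates of `(1, u_1, …, u_1^k, …, u_d, …, u_d^k, ψ(u))`; the pair
`(i, j)` stands for the power `u_i^(j+1)`. -/
abbrev StatIndex (d k q : ℕ) : Type := Unit ⊕ (Fin d × Fin k) ⊕ Fin q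

/-- `φ^k(u) = (1, u_1, …, u_1^k, …, u_d, …, u_d^k, ψ(u))`. -/
def stat {d q : ℕ} (k : ℕ) (ψ : (Fin d → ℝ) → Fin q → ℝ) (u : Fin d → ℝ) :
    StatIndex d k q → ℝ :=
  Sum.elim (fun _ => 1) (Sum.elim (fun ij => u ij.1 ^ (ij.2.val + 1)) (ψ u))

/-- `α^k = (1, 1/2, …, 1/(1+k), …, 1/2, …, 1/(1+k), β)`. -/
def statMean (d : ℕ) {q : ℕ} (k : ℕ) (β : Fin q → ℝ) : StatIndex d k q → ℝ :=
  Sum.elim (fun _ => 1) (Sum.elim (fun ij => 1 / (1 + ((ij.2.val + 1 : ℕ) : ℝ))) β)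

/-- `h_M(u; ψ, β)`. -/
def hM {d q : ℕ} (ψ : (Fin d → ℝ) → Fin q → ℝ) (β : Fin q → ℝ) : EReal := mind ψ β

/-- `h_AM(u; φ^k, β)`. -/
def hAM {d q : ℕ} (k : ℕ) (ψ : (Fin d → ℝ) → Fin q → ℝ) (β : Fin q → ℝ) : EReal :=
  amind (stat k ψ) (statMean d k β)

/-- The expectations `E_Q[ψ(u)]` for copula distributions `Q` with pdf and finite entropy (the
entropy of a distribution on the cube is at most zero, hence finite unless it is `-∞`). -/
def copulaMeans {d q : ℕ} (ψ : (Fin d → ℝ) → Fin q → ℝ) : Set (Fin q → ℝ) :=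
  {b | ∃ Q : Measure (Fin d → ℝ), IsCopulaLaw Q ∧ diffEntropy Q ≠ ⊥ ∧ expect Q ψ = b}

/-- The family `(φ_m)_m` is a universal approximator of continuous functions on `[0,1]^d`: the
uniform distance of any continuous function to the linear span of the coordinates of `φ_m` tends
to zero as `m → ∞`. -/
def UniversalApproximator {d : ℕ} {ι : ℕ → Type} [∀ m, Fintype (ι m)]
    (φ : (m : ℕ) → (Fin d → ℝ) → ι m → ℝ) : Prop :=
  ∀ f : (Fin d → ℝ) → ℝ, ContinuousOn f (cube d) → ∀ ε > 0, ∀ᶠ m in atTop,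
    ∃ θ : ι m → ℝ, ∀ u ∈ cube d, |f u - ∑ j, θ j * φ m u j| < ε

/-- The coordinates of `φ` are not linearly dependent `P`-almost surely. -/
def LinIndepAS {d : ℕ} {ι : Type*} [Fintype ι] (P : Measure (Fin d → ℝ))
    (φ : (Fin d → ℝ) → ι → ℝ) : Prop :=
  ∀ θ : ι → ℝ, (∀ᵐ u ∂P, ∑ j, θ j * φ u j = 0) → θ = 0

/-- The copula-uniform dual representation `u_z = (F_1(z_1), …, F_d(z_d))` of a random vector `z`,
where `F_i` is the cdf of `z_i`. -/
def dualRep {Ω : Type*} [MeasurableSpace Ω] {d : ℕ} (μ : Measure Ω) (z : Ω → Fin d → ℝ) :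
    Ω → Fin d → ℝ :=
  fun ω i => cdf (μ.map (fun ω' => z ω' i)) (z ω i)

/-- Convergence in probability of `X i` to a constant `a` along `l`, in a topological space. -/
def TendstoInProb {Ω ι E : Type*} [MeasurableSpace Ω] [TopologicalSpace E] (μ : Measure Ω)
    (X : ι → Ω → E) (l : Filter ι) (a : E) : Prop :=
  ∀ U ∈ 𝓝 a, Tendsto (fun i => μ {ω | X i ω ∉ U}) l (𝓝 0)

/-- The filter of pairs `(r, n)` such that `r, n → ∞` with `n ≥ N(r)`. -/
def jointly (N : ℕ → ℕ) : Filter (ℕ × ℕ) :=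
  (atTop ×ˢ atTop) ⊓ 𝓟 {p | N p.1 ≤ p.2}

end MaxEntCopula

end

/-!
On the cube, differential entropy is minus the Kullback–Leibler divergence from the uniform
distribution, so every value in the theorem is minus an infimum of a convex divergence over
densities with prescribed moments; the copula densities are those with the moments of the uniform
distribution in each coordinate, for all degrees at once.

* `n → ∞`: the infimum is convex in the moments, and by non-degeneracy it is finite near the true
  moments, hence continuous there.
* `k → ∞`: near-minimizers over decreasing convex classes that are closed in `L¹` form a Cauchy
  sequence in `L¹`, and their limit minimizes over the intersection.
* `m → ∞`: the divergence is the supremum of `∫ p f - ∫ (e^f - 1)` over continuous `f`, and for `f`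
  close to the span of the statistics this functional almost depends on the moments of `p` only.
* `k, n → ∞` jointly: convex functions of the moments with a common bound near an interior point are
  equi-Lipschitz there.
-/

noncomputable section

namespace MaxEntCopula

open InformationTheory
open scoped Matrix

section KLFun

lemma mul_le_klFun_add_exp_sub_one {x : ℝ} (hx : 0 ≤ x) (y : ℝ) :
    x * y ≤ klFun x + (Real.exp y - 1) := by
  rcases hx.eq_or_lt with rfl | hx
  · simpa [klFun_zero] using Real.exp_nonneg y
  · have hexp : x * (y - Real.log x + 1) ≤ Real.exp y :=
      calc x * (y - Real.log x + 1) ≤ x * Real.exp (y - Real.log x) :=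
            mul_le_mul_of_nonneg_left (Real.add_one_le_exp _) hx.le
        _ = Real.exp y := by rw [Real.exp_sub, Real.exp_log hx, mul_div_cancel₀ _ hx.ne']
    rw [klFun_apply]
    linarith

lemma sub_sq_le_log_one_add {ε : ℝ} (hε : 0 ≤ ε) : ε - ε ^ 2 ≤ Real.log (1 + ε) := by
  have hpos : 0 < 1 + ε := by positivity
  calc ε - ε ^ 2 ≤ 1 - (1 + ε)⁻¹ := by
        rw [← sub_nonneg]
        have : 1 - (1 + ε)⁻¹ - (ε - ε ^ 2) = ε ^ 3 * (1 + ε)⁻¹ := by field_simp; ring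
        rw [this]; positivity
    _ ≤ Real.log (1 + ε) := Real.one_sub_inv_le_log_of_pos hpos

lemma neg_sub_two_mul_sq_le_log_one_sub {ε : ℝ} (hε : ε ≤ 1 / 2) :
    -ε - 2 * ε ^ 2 ≤ Real.log (1 - ε) := by
  have hpos : 0 < 1 - ε := by linarith
  calc -ε - 2 * ε ^ 2 ≤ 1 - (1 - ε)⁻¹ := by
        rw [← sub_nonneg]
        have : 1 - (1 - ε)⁻¹ - (-ε - 2 * ε ^ 2) = ε ^ 2 * (1 - 2 * ε) * (1 - ε)⁻¹ := by
          field_simp; ring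
        rw [this]
        exact mul_nonneg (mul_nonneg (sq_nonneg _) (by linarith)) (inv_nonneg.2 hpos.le)
    _ ≤ Real.log (1 - ε) := Real.one_sub_inv_le_log_of_pos hpos

/- Fenchel–Young at `a` and `b`, with slopes `log ((1 ± ε) m)` slightly off the slope `log m` at the
midpoint `m`: the first-order gain is `ε |a - b|`, the loss only of order `ε ^ 2`. -/
lemma mul_abs_sub_add_klFun_midpoint_le {a b ε : ℝ} (ha : 0 ≤ a) (hb : 0 ≤ b) (hε : 0 ≤ ε)
    (hε' : ε ≤ 1 / 2) :
    ε * |a - b| + 2 * klFun ((a + b) / 2) ≤ 2 * ε ^ 2 * (a + b) + (klFun a + klFun b) := by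
  wlog hab : b ≤ a generalizing a b
  · simpa only [abs_sub_comm b a, add_comm b a, add_comm (klFun b)] using
      this hb ha (le_of_not_ge hab)
  rcases ha.eq_or_lt with rfl | ha
  · obtain rfl : b = 0 := le_antisymm hab hb
    simp [two_mul]
  set m := (a + b) / 2 with hm
  have hm0 : 0 < m := by positivity
  have hplus := mul_le_klFun_add_exp_sub_one ha.le (Real.log m + Real.log (1 + ε))
  have hminus := mul_le_klFun_add_exp_sub_one hb (Real.log m + Real.log (1 - ε))
  rw [Real.exp_add, Real.exp_log hm0, Real.exp_log (by linarith)] at hplus hminus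
  have hlog_plus := mul_le_mul_of_nonneg_left (sub_sq_le_log_one_add hε) ha.le
  have hlog_minus := mul_le_mul_of_nonneg_left (neg_sub_two_mul_sq_le_log_one_sub hε') hb
  have hsq : 0 ≤ a * ε ^ 2 := by positivity
  rw [abs_of_nonneg (sub_nonneg.2 hab), klFun_apply m]
  have hmlog : (a + b) * Real.log m = 2 * (m * Real.log m) := by rw [hm]; ring
  linarith

end KLFun

section Divergence

variable {α : Type*} [MeasurableSpace α] {ν : Measure α} {g h : α → ℝ}

/-- `g` is a probability density with respect to `ν`. -/
structure IsDensity (ν : Measure α) (g : α → ℝ) : Prop where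
  integrable : Integrable g ν
  nonneg : 0 ≤ᵐ[ν] g
  integral_eq_one : ∫ x, g x ∂ν = 1

/-- The Kullback–Leibler divergence from `ν` of the probability measure with density `g`.
Integrating `klFun x = x log x + 1 - x`, which is nonnegative, instead of `x log x` makes the value
meaningful without any integrability assumption. -/
def divergence (ν : Measure α) (g : α → ℝ) : ℝ≥0∞ :=
  ∫⁻ x, ENNReal.ofReal (klFun (g x)) ∂ν

lemma aemeasurable_ofReal_klFun (hg : AEStronglyMeasurable g ν) :
    AEMeasurable (fun x => ENNReal.ofReal (klFun (g x))) ν :=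
  (measurable_klFun.comp_aemeasurable hg.aemeasurable).ennreal_ofReal

lemma IsDensity.convexComb (hg : IsDensity ν g) (hh : IsDensity ν h) {s t : ℝ} (hs : 0 ≤ s)
    (ht : 0 ≤ t) (hst : s + t = 1) : IsDensity ν (s • g + t • h) where
  integrable := (hg.integrable.smul s).add (hh.integrable.smul t)
  nonneg := by
    filter_upwards [hg.nonneg, hh.nonneg] with x hgx hhx
    exact add_nonneg (mul_nonneg hs hgx) (mul_nonneg ht hhx)
  integral_eq_one := by
    rw [integral_add' (hg.integrable.smul s) (hh.integrable.smul t)]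
    simp only [Pi.smul_apply, smul_eq_mul, integral_const_mul, hg.integral_eq_one,
      hh.integral_eq_one, mul_one, hst]

lemma divergence_convexComb_le (hg : IsDensity ν g) (hh : IsDensity ν h) {s t : ℝ} (hs : 0 ≤ s)
    (ht : 0 ≤ t) (hst : s + t = 1) :
    divergence ν (s • g + t • h) ≤
      ENNReal.ofReal s * divergence ν g + ENNReal.ofReal t * divergence ν h := by
  have hmeas := aemeasurable_ofReal_klFun hg.integrable.1
  unfold divergence
  rw [← lintegral_const_mul'' _ hmeas,
    ← lintegral_const_mul'' _ (aemeasurable_ofReal_klFun hh.integrable.1),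
    ← lintegral_add_left' (hmeas.const_mul _)]
  refine lintegral_mono_ae ?_
  filter_upwards [hg.nonneg, hh.nonneg] with x hgx hhx
  rw [← ENNReal.ofReal_mul hs, ← ENNReal.ofReal_mul ht, ← ENNReal.ofReal_add
    (mul_nonneg hs (klFun_nonneg hgx)) (mul_nonneg ht (klFun_nonneg hhx))]
  exact ENNReal.ofReal_le_ofReal (convexOn_klFun.2 hgx hhx hs ht hst)

lemma IsDensity.aemeasurable_ofReal (hg : IsDensity ν g) :
    AEMeasurable (fun x => ENNReal.ofReal (g x)) ν :=
  hg.integrable.aestronglyMeasurable.aemeasurable.ennreal_ofReal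

lemma IsDensity.lintegral_eq_one (hg : IsDensity ν g) : ∫⁻ x, ENNReal.ofReal (g x) ∂ν = 1 := by
  rw [← ofReal_integral_eq_lintegral_ofReal hg.integrable hg.nonneg, hg.integral_eq_one,
    ENNReal.ofReal_one]

lemma ofReal_mul_enorm_sub_add_klFun_midpoint_le {a b ε : ℝ} (ha : 0 ≤ a) (hb : 0 ≤ b)
    (hε : 0 ≤ ε) (hε' : ε ≤ 1 / 2) :
    ENNReal.ofReal ε * ‖a - b‖ₑ + 2 * ENNReal.ofReal (klFun ((a + b) / 2)) ≤
      ENNReal.ofReal (2 * ε ^ 2) * (ENNReal.ofReal a + ENNReal.ofReal b) +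
        (ENNReal.ofReal (klFun a) + ENNReal.ofReal (klFun b)) := by
  have hmid : 0 ≤ klFun ((a + b) / 2) := klFun_nonneg (by positivity)
  have hsum : 0 ≤ klFun a + klFun b := add_nonneg (klFun_nonneg ha) (klFun_nonneg hb)
  rw [Real.enorm_eq_ofReal_abs, ← ENNReal.ofReal_ofNat 2, ← ENNReal.ofReal_mul hε,
    ← ENNReal.ofReal_mul zero_le_two, ← ENNReal.ofReal_add (by positivity) (by positivity),
    ← ENNReal.ofReal_add ha hb, ← ENNReal.ofReal_mul (by positivity),
    ← ENNReal.ofReal_add (klFun_nonneg ha) (klFun_nonneg hb),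
    ← ENNReal.ofReal_add (by positivity) hsum]
  exact ENNReal.ofReal_le_ofReal (mul_abs_sub_add_klFun_midpoint_le ha hb hε hε')

lemma ofReal_mul_eLpNorm_sub_add_divergence_midpoint_le (hg : IsDensity ν g) (hh : IsDensity ν h)
    {ε : ℝ} (hε : 0 ≤ ε) (hε' : ε ≤ 1 / 2) :
    ENNReal.ofReal ε * eLpNorm (g - h) 1 ν + 2 * divergence ν ((1 / 2 : ℝ) • g + (1 / 2 : ℝ) • h) ≤
      ENNReal.ofReal (4 * ε ^ 2) + (divergence ν g + divergence ν h) := by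
  have hmid : (1 / 2 : ℝ) • g + (1 / 2 : ℝ) • h = fun x => (g x + h x) / 2 := by
    ext x; simp only [Pi.add_apply, Pi.smul_apply, smul_eq_mul]; ring
  have hmeas : AEMeasurable (fun x => ENNReal.ofReal (klFun ((g x + h x) / 2))) ν :=
    aemeasurable_ofReal_klFun ((hg.integrable.add hh.integrable).div_const 2).1
  have hdist : AEMeasurable (fun x => ‖g x - h x‖ₑ) ν := (hg.integrable.sub hh.integrable).1.enorm
  have hsum : AEMeasurable (fun x => ENNReal.ofReal (g x) + ENNReal.ofReal (h x)) ν :=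
    hg.aemeasurable_ofReal.add hh.aemeasurable_ofReal
  calc _ = ∫⁻ x, (ENNReal.ofReal ε * ‖g x - h x‖ₑ +
          2 * ENNReal.ofReal (klFun ((g x + h x) / 2))) ∂ν := by
        rw [lintegral_add_left' (hdist.const_mul _), lintegral_const_mul'' _ hdist,
          lintegral_const_mul'' _ hmeas,
          eLpNorm_one_eq_lintegral_enorm, hmid, divergence]
        rfl
    _ ≤ ∫⁻ x, (ENNReal.ofReal (2 * ε ^ 2) * (ENNReal.ofReal (g x) + ENNReal.ofReal (h x)) +
          (ENNReal.ofReal (klFun (g x)) + ENNReal.ofReal (klFun (h x)))) ∂ν := by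
        refine lintegral_mono_ae ?_
        filter_upwards [hg.nonneg, hh.nonneg] with x hgx hhx
        exact ofReal_mul_enorm_sub_add_klFun_midpoint_le hgx hhx hε hε'
    _ = ENNReal.ofReal (2 * ε ^ 2) * (1 + 1) + (divergence ν g + divergence ν h) := by
        rw [lintegral_add_left' (hsum.const_mul _), lintegral_const_mul'' _ hsum,
          lintegral_add_left' hg.aemeasurable_ofReal, hg.lintegral_eq_one, hh.lintegral_eq_one,
          lintegral_add_left' (aemeasurable_ofReal_klFun hg.integrable.1), divergence, divergence]
    _ = _ := by
        rw [one_add_one_eq_two, ← ENNReal.ofReal_ofNat 2, ← ENNReal.ofReal_mul (by positivity)]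
        ring_nf

end Divergence

section InfDivergence

variable {α : Type*} [MeasurableSpace α] {ν : Measure α} {C : Set (α → ℝ)}

/-- The infimum of the divergence from `ν` over a class of densities. -/
def infDivergence (ν : Measure α) (C : Set (α → ℝ)) : ℝ≥0∞ :=
  ⨅ g ∈ C, divergence ν g

lemma infDivergence_le {g : α → ℝ} (hg : g ∈ C) : infDivergence ν C ≤ divergence ν g :=
  iInf₂_le g hg

lemma infDivergence_anti {C' : Set (α → ℝ)} (h : C ⊆ C') :
    infDivergence ν C' ≤ infDivergence ν C :=
  biInf_mono h

lemma exists_divergence_lt {a : ℝ≥0∞} (h : infDivergence ν C < a) :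
    ∃ g ∈ C, divergence ν g < a := by
  simpa only [infDivergence, iInf_lt_iff, exists_prop] using h

end InfDivergence

section ConvexFamilies

variable {α E : Type*} [MeasurableSpace α] {ν : Measure α} [AddCommGroup E] [Module ℝ E]
  {C : E → Set (α → ℝ)}

/-- A family of sets of densities which is jointly convex in the parameter and the density; the
minimal divergence over its members is then a convex function of the parameter. -/
structure IsConvexFamily (ν : Measure α) (C : E → Set (α → ℝ)) : Prop where
  isDensity : ∀ x, ∀ g ∈ C x, IsDensity ν g
  convexComb_mem : ∀ ⦃x y g h⦄, g ∈ C x → h ∈ C y → ∀ ⦃s t : ℝ⦄, 0 ≤ s → 0 ≤ t → s + t = 1 →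
    s • g + t • h ∈ C (s • x + t • y)

namespace IsConvexFamily

lemma convex (hC : IsConvexFamily ν C) (x : E) : Convex ℝ (C x) := fun _ hg _ hh s t hs ht hst => by
  simpa only [← add_smul, hst, one_smul] using hC.convexComb_mem hg hh hs ht hst

lemma iInter {ι : Type*} [Nonempty ι] {C : ι → E → Set (α → ℝ)}
    (hC : ∀ i, IsConvexFamily ν (C i)) : IsConvexFamily ν fun x => ⋂ i, C i x where
  isDensity x g hg := (hC (Classical.arbitrary ι)).isDensity x g (Set.mem_iInter.1 hg _)
  convexComb_mem _ _ _ _ hg hh _ _ hs ht hst := Set.mem_iInter.2 fun i =>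
    (hC i).convexComb_mem (Set.mem_iInter.1 hg i) (Set.mem_iInter.1 hh i) hs ht hst

lemma comp {E' : Type*} [AddCommGroup E'] [Module ℝ E'] (hC : IsConvexFamily ν C) {a : E' → E}
    (ha : ∀ x y, ∀ s t : ℝ, s + t = 1 → a (s • x + t • y) = s • a x + t • a y) :
    IsConvexFamily ν fun x => C (a x) where
  isDensity x := hC.isDensity (a x)
  convexComb_mem x y _ _ hg hh s t hs ht hst := by
    rw [ha x y s t hst]
    exact hC.convexComb_mem hg hh hs ht hst

lemma infDivergence_convexComb_le (hC : IsConvexFamily ν C) {x y : E}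
    (hx : infDivergence ν (C x) ≠ ∞) (hy : infDivergence ν (C y) ≠ ∞) {s t : ℝ} (hs : 0 ≤ s)
    (ht : 0 ≤ t) (hst : s + t = 1) :
    infDivergence ν (C (s • x + t • y)) ≤
      ENNReal.ofReal s * infDivergence ν (C x) + ENNReal.ofReal t * infDivergence ν (C y) := by
  refine ENNReal.le_of_forall_pos_le_add fun δ hδ _ => ?_
  have hδ' : (δ : ℝ≥0∞) ≠ 0 := ENNReal.coe_ne_zero.2 hδ.ne'
  obtain ⟨g, hg, hgx⟩ := exists_divergence_lt (ENNReal.lt_add_right hx hδ')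
  obtain ⟨h, hh, hhy⟩ := exists_divergence_lt (ENNReal.lt_add_right hy hδ')
  calc infDivergence ν (C (s • x + t • y)) ≤ divergence ν (s • g + t • h) :=
        infDivergence_le (hC.convexComb_mem hg hh hs ht hst)
    _ ≤ ENNReal.ofReal s * divergence ν g + ENNReal.ofReal t * divergence ν h :=
        divergence_convexComb_le (hC.isDensity x g hg) (hC.isDensity y h hh) hs ht hst
    _ ≤ ENNReal.ofReal s * (infDivergence ν (C x) + δ) +
          ENNReal.ofReal t * (infDivergence ν (C y) + δ) := by gcongr
    _ = ENNReal.ofReal s * infDivergence ν (C x) + ENNReal.ofReal t * infDivergence ν (C y) +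
          (ENNReal.ofReal s + ENNReal.ofReal t) * δ := by ring
    _ = _ := by rw [← ENNReal.ofReal_add hs ht, hst, ENNReal.ofReal_one, one_mul]

lemma convexOn_toReal_infDivergence (hC : IsConvexFamily ν C) {S : Set E} (hS : Convex ℝ S)
    (hfin : ∀ x ∈ S, infDivergence ν (C x) ≠ ∞) :
    ConvexOn ℝ S fun x => (infDivergence ν (C x)).toReal := by
  refine ⟨hS, fun x hx y hy s t hs ht hst => ?_⟩
  have hx' : ENNReal.ofReal s * infDivergence ν (C x) ≠ ∞ :=
    ENNReal.mul_ne_top ENNReal.ofReal_ne_top (hfin x hx)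
  have hy' : ENNReal.ofReal t * infDivergence ν (C y) ≠ ∞ :=
    ENNReal.mul_ne_top ENNReal.ofReal_ne_top (hfin y hy)
  rw [smul_eq_mul, smul_eq_mul, ← ENNReal.toReal_ofReal_mul _ _ hs,
    ← ENNReal.toReal_ofReal_mul _ _ ht, ← ENNReal.toReal_add hx' hy']
  exact ENNReal.toReal_mono (ENNReal.add_ne_top.2 ⟨hx', hy'⟩)
    (hC.infDivergence_convexComb_le (hfin x hx) (hfin y hy) hs ht hst)

end IsConvexFamily

end ConvexFamilies

section L1Convergence

variable {α : Type*} [MeasurableSpace α] {ν : Measure α} {g : ℕ → α → ℝ} {G : α → ℝ}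

lemma exists_seq_tendsto_ae_of_tendsto_eLpNorm (hg : ∀ n, Integrable (g n) ν) (hG : Integrable G ν)
    (h : Tendsto (fun n => eLpNorm (g n - G) 1 ν) atTop (𝓝 0)) :
    ∃ ns : ℕ → ℕ, StrictMono ns ∧ ∀ᵐ x ∂ν, Tendsto (fun i => g (ns i) x) atTop (𝓝 (G x)) :=
  (tendstoInMeasure_of_tendsto_eLpNorm one_ne_zero (fun n => (hg n).1) hG.1 h).exists_seq_tendsto_ae

lemma divergence_le_of_tendsto_eLpNorm (hg : ∀ n, Integrable (g n) ν) (hG : Integrable G ν)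
    (h : Tendsto (fun n => eLpNorm (g n - G) 1 ν) atTop (𝓝 0)) {c : ℝ≥0∞}
    (hc : ∀ᶠ n in atTop, divergence ν (g n) ≤ c) : divergence ν G ≤ c := by
  obtain ⟨ns, hns, hae⟩ := exists_seq_tendsto_ae_of_tendsto_eLpNorm hg hG h
  calc divergence ν G
      = ∫⁻ x, liminf (fun i => ENNReal.ofReal (klFun (g (ns i) x))) atTop ∂ν := by
        refine lintegral_congr_ae (hae.mono fun x hx => ?_)
        exact (ENNReal.tendsto_ofReal
          ((continuous_klFun.tendsto (G x)).comp hx)).liminf_eq.symm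
    _ ≤ liminf (fun i => divergence ν (g (ns i))) atTop :=
        lintegral_liminf_le' fun i => aemeasurable_ofReal_klFun (hg (ns i)).1
    _ ≤ c := liminf_le_of_frequently_le' (hns.tendsto_atTop.eventually hc).frequently

lemma tendsto_integral_mul_of_tendsto_eLpNorm (hg : ∀ n, Integrable (g n) ν) (hG : Integrable G ν)
    (h : Tendsto (fun n => eLpNorm (g n - G) 1 ν) atTop (𝓝 0)) {f : α → ℝ} (hf : MemLp f ∞ ν) :
    Tendsto (fun n => ∫ x, g n x * f x ∂ν) atTop (𝓝 (∫ x, G x * f x ∂ν)) := by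
  refine tendsto_integral_of_L1' (G * f) (hG.mul_of_top_left hf).1 (F := fun n => g n * f)
    (Eventually.of_forall fun n => (hg n).mul_of_top_left hf) ?_
  have hbound : ∀ n, eLpNorm (g n * f - G * f) 1 ν ≤ eLpNorm f ∞ ν * eLpNorm (g n - G) 1 ν := by
    intro n
    rw [← sub_mul, mul_comm]
    exact eLpNorm_smul_le_eLpNorm_top_mul_eLpNorm 1 ((hg n).sub hG).1 f
  have hzero := ENNReal.Tendsto.const_mul h (Or.inr hf.2.ne)
  rw [mul_zero] at hzero
  exact tendsto_of_tendsto_of_tendsto_of_le_of_le tendsto_const_nhds hzero (fun _ => zero_le)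
    hbound

lemma isDensity_of_tendsto_eLpNorm (hg : ∀ n, IsDensity ν (g n)) (hG : Integrable G ν)
    (h : Tendsto (fun n => eLpNorm (g n - G) 1 ν) atTop (𝓝 0)) : IsDensity ν G where
  integrable := hG
  nonneg := by
    obtain ⟨ns, -, hae⟩ :=
      exists_seq_tendsto_ae_of_tendsto_eLpNorm (fun n => (hg n).integrable) hG h
    filter_upwards [hae, ae_all_iff.2 fun i => (hg (ns i)).nonneg] with x hx hnonneg
    exact ge_of_tendsto' hx hnonneg
  integral_eq_one := by
    refine tendsto_nhds_unique (tendsto_integral_of_L1' G hG.1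
      (Eventually.of_forall fun n => (hg n).integrable) h) ?_
    simp only [(hg _).integral_eq_one, tendsto_const_nhds]

/-- A set of functions is `L¹`-closed if it contains the integrable limits in `L¹` of its
sequences. -/
def IsL1Closed (ν : Measure α) (C : Set (α → ℝ)) : Prop :=
  ∀ ⦃g : ℕ → α → ℝ⦄ ⦃G : α → ℝ⦄, (∀ n, g n ∈ C) → Integrable G ν →
    Tendsto (fun n => eLpNorm (g n - G) 1 ν) atTop (𝓝 0) → G ∈ C

end L1Convergence

section MomentClass

variable {α ι : Type*} [MeasurableSpace α] {ν : Measure α} {φ : α → ι → ℝ}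

/-- The densities `g` with respect to `ν` with prescribed moments `∫ g φ_j dν = a_j`. -/
def momentClass (ν : Measure α) (φ : α → ι → ℝ) (a : ι → ℝ) : Set (α → ℝ) :=
  {g | IsDensity ν g ∧ ∀ j, ∫ x, g x * φ x j ∂ν = a j}

lemma isConvexFamily_momentClass (hφ : ∀ j, MemLp (fun x => φ x j) ∞ ν) :
    IsConvexFamily ν (momentClass ν φ) where
  isDensity _ _ hg := hg.1
  convexComb_mem a b g h hg hh s t hs ht hst := by
    refine ⟨hg.1.convexComb hh.1 hs ht hst, fun j => ?_⟩
    have hgj := (hg.1.integrable.mul_of_top_left (hφ j)).const_mul s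
    have hhj := (hh.1.integrable.mul_of_top_left (hφ j)).const_mul t
    calc ∫ x, (s • g + t • h) x * φ x j ∂ν
        = ∫ x, (s * (g x * φ x j) + t * (h x * φ x j)) ∂ν := by
          simp only [Pi.add_apply, Pi.smul_apply, smul_eq_mul, add_mul, mul_assoc]
      _ = s * a j + t * b j := by
          rw [← hg.2 j, ← hh.2 j, ← integral_const_mul, ← integral_const_mul]
          exact integral_add hgj hhj

lemma isL1Closed_momentClass (hφ : ∀ j, MemLp (fun x => φ x j) ∞ ν) (a : ι → ℝ) :
    IsL1Closed ν (momentClass ν φ a) := by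
  intro g G hg hG h
  refine ⟨isDensity_of_tendsto_eLpNorm (fun n => (hg n).1) hG h, fun j => ?_⟩
  have hlim := tendsto_integral_mul_of_tendsto_eLpNorm (fun n => (hg n).1.integrable) hG h (hφ j)
  simp only [(hg _).2 j] at hlim
  exact tendsto_nhds_unique hlim tendsto_const_nhds

end MomentClass

section DecreasingClasses

variable {α : Type*} [MeasurableSpace α] {ν : Measure α} {C : ℕ → Set (α → ℝ)}

lemma eLpNorm_sub_le_of_divergence_le {g h : α → ℝ} (hg : IsDensity ν g) (hh : IsDensity ν h)
    {ε : ℝ} (hε : 0 < ε) (hε' : ε ≤ 1 / 2) {L : ℝ≥0∞} (hL : L ≠ ∞)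
    (hgL : divergence ν g ≤ L + ENNReal.ofReal (ε ^ 2))
    (hhL : divergence ν h ≤ L + ENNReal.ofReal (ε ^ 2))
    (hmid : L ≤ divergence ν ((1 / 2 : ℝ) • g + (1 / 2 : ℝ) • h) + ENNReal.ofReal (ε ^ 2)) :
    eLpNorm (g - h) 1 ν ≤ ENNReal.ofReal (8 * ε) := by
  have hfin : 2 * L ≠ ∞ := ENNReal.mul_ne_top ENNReal.ofNat_ne_top hL
  have hofReal : ENNReal.ofReal (4 * ε ^ 2) = 4 * ENNReal.ofReal (ε ^ 2) := by
    rw [ENNReal.ofReal_mul zero_le_four, ENNReal.ofReal_ofNat]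
  have hsum : ENNReal.ofReal ε * eLpNorm (g - h) 1 ν + 2 * L ≤
      ENNReal.ofReal ε * ENNReal.ofReal (8 * ε) + 2 * L :=
    calc ENNReal.ofReal ε * eLpNorm (g - h) 1 ν + 2 * L
        ≤ ENNReal.ofReal ε * eLpNorm (g - h) 1 ν +
            2 * (divergence ν ((1 / 2 : ℝ) • g + (1 / 2 : ℝ) • h) + ENNReal.ofReal (ε ^ 2)) := by
          gcongr
      _ ≤ ENNReal.ofReal (4 * ε ^ 2) + (divergence ν g + divergence ν h) +
            2 * ENNReal.ofReal (ε ^ 2) := by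
          rw [mul_add, ← add_assoc]
          refine add_le_add_left ?_ _
          exact ofReal_mul_eLpNorm_sub_add_divergence_midpoint_le hg hh hε.le hε'
      _ ≤ 4 * ENNReal.ofReal (ε ^ 2) +
            (L + ENNReal.ofReal (ε ^ 2) + (L + ENNReal.ofReal (ε ^ 2))) +
            2 * ENNReal.ofReal (ε ^ 2) := by
          rw [hofReal]
          gcongr
      _ = 8 * ENNReal.ofReal (ε ^ 2) + 2 * L := by ring
      _ = ENNReal.ofReal ε * ENNReal.ofReal (8 * ε) + 2 * L := by
          rw [← ENNReal.ofReal_mul hε.le, ← ENNReal.ofReal_ofNat 8,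
            ← ENNReal.ofReal_mul (by norm_num)]
          ring_nf
  exact (ENNReal.mul_le_mul_iff_right (ENNReal.ofReal_pos.2 hε).ne' ENNReal.ofReal_ne_top).1
    ((ENNReal.add_le_add_iff_right hfin).1 hsum)

lemma exists_divergence_le_iSup_add (hanti : Antitone C) (hL : ⨆ n, infDivergence ν (C n) ≠ ∞)
    {δ : ℝ≥0∞} (hδ : δ ≠ 0) (N : ℕ) :
    ∃ k ≥ N, ∃ g ∈ C k, divergence ν g ≤ (⨆ n, infDivergence ν (C n)) + δ ∧
      ⨆ n, infDivergence ν (C n) ≤ infDivergence ν (C k) + δ := by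
  obtain ⟨k, hk⟩ : ∃ k, ⨆ n, infDivergence ν (C n) ≤ infDivergence ν (C k) + δ := by
    by_contra! hlt
    refine (ENNReal.lt_add_right hL hδ).not_ge ?_
    rw [ENNReal.iSup_add]
    exact iSup_le fun n => (hlt n).le
  obtain ⟨g, hg, hgL⟩ := exists_divergence_lt ((le_iSup (fun n => infDivergence ν (C n))
    (max k N)).trans_lt (ENNReal.lt_add_right hL hδ))
  refine ⟨max k N, le_max_right k N, g, hg, hgL.le, hk.trans ?_⟩
  gcongr
  exact infDivergence_anti (hanti (le_max_left k N))

/- Near-minimizers are Cauchy in `L¹` by the quantitative convexity of the divergence, so that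
completeness of `L¹` replaces weak compactness. -/
lemma exists_cauchy_minimizing_seq (hanti : Antitone C) (hdens : ∀ g ∈ C 0, IsDensity ν g)
    (hconv : ∀ n, Convex ℝ (C n)) (hL : ⨆ n, infDivergence ν (C n) ≠ ∞) :
    ∃ g : ℕ → α → ℝ, (∀ n, g n ∈ C n) ∧
      (∀ c > ⨆ n, infDivergence ν (C n), ∀ᶠ n in atTop, divergence ν (g n) ≤ c) ∧
      ∀ N n m, N ≤ n → N ≤ m →
        eLpNorm (g n - g m) 1 ν < ENNReal.ofReal (9 * (1 / 2) ^ (N + 1)) := by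
  set L := ⨆ n, infDivergence ν (C n)
  set ε : ℕ → ℝ := fun n => (1 / 2) ^ (n + 1)
  have hε : ∀ n, 0 < ε n := fun n => by positivity
  have hε_sq : ∀ {N n}, N ≤ n → ENNReal.ofReal (ε n ^ 2) ≤ ENNReal.ofReal (ε N ^ 2) := fun h =>
    ENNReal.ofReal_le_ofReal (pow_le_pow_left₀ (hε _).le
      (pow_le_pow_of_le_one (by norm_num) (by norm_num) (Nat.succ_le_succ h)) 2)
  choose k hk g hgC hgL hkL using fun n => exists_divergence_le_iSup_add hanti hL
    (ENNReal.ofReal_pos.2 (pow_pos (hε n) 2)).ne' n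
  have hg : ∀ n, IsDensity ν (g n) := fun n => hdens _ (hanti zero_le (hgC n))
  refine ⟨g, fun n => hanti (hk n) (hgC n), fun c hc => ?_, fun N n m hn hm => ?_⟩
  · have hε_zero : Tendsto ε atTop (𝓝 0) :=
      (tendsto_add_atTop_iff_nat 1).2 (tendsto_pow_atTop_nhds_zero_of_lt_one (by norm_num)
        (by norm_num))
    have hbound : Tendsto (fun n => L + ENNReal.ofReal (ε n ^ 2)) atTop (𝓝 L) := by
      simpa using tendsto_const_nhds.add (ENNReal.tendsto_ofReal (hε_zero.pow 2))
    exact (hbound.eventually_lt_const hc).mono fun n hn => (hgL n).trans hn.le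
  · wlog hnm : k n ≤ k m generalizing n m
    · rw [eLpNorm_sub_comm]
      exact this m n hm hn (le_of_not_ge hnm)
    have hmid := hconv (k n) (hgC n) (hanti hnm (hgC m)) one_half_pos.le one_half_pos.le
      (add_halves 1)
    have hdist : eLpNorm (g n - g m) 1 ν ≤ ENNReal.ofReal (8 * ε N) :=
      eLpNorm_sub_le_of_divergence_le (hg n) (hg m) (hε N)
        (pow_le_of_le_one (by norm_num) (by norm_num) (Nat.succ_ne_zero N)) hL
        ((hgL n).trans (add_le_add_right (hε_sq hn) L))
        ((hgL m).trans (add_le_add_right (hε_sq hm) L))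
        ((hkL n).trans (add_le_add (infDivergence_le hmid) (hε_sq hn)))
    refine hdist.trans_lt ((ENNReal.ofReal_lt_ofReal_iff (by positivity)).2 ?_)
    linarith [hε N]

lemma exists_mem_iInter_divergence_le (hanti : Antitone C) (hdens : ∀ g ∈ C 0, IsDensity ν g)
    (hconv : ∀ n, Convex ℝ (C n)) (hclosed : ∀ n, IsL1Closed ν (C n))
    (hL : ⨆ n, infDivergence ν (C n) ≠ ∞) :
    ∃ G ∈ ⋂ n, C n, divergence ν G ≤ ⨆ n, infDivergence ν (C n) := by
  obtain ⟨g, hgC, hgL, hcauchy⟩ := exists_cauchy_minimizing_seq hanti hdens hconv hL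
  have hg : ∀ n, Integrable (g n) ν := fun n => (hdens _ (hanti zero_le (hgC n))).integrable
  have hsum : Summable fun n : ℕ => (1 / 2 : ℝ) ^ (n + 1) :=
    (summable_nat_add_iff 1).2 summable_geometric_two
  obtain ⟨G, hG, hlim⟩ := Lp.cauchy_complete_eLpNorm le_rfl
    (fun n => memLp_one_iff_integrable.2 (hg n)) (hsum.mul_left 9).tsum_ofReal_ne_top hcauchy
  rw [memLp_one_iff_integrable] at hG
  refine ⟨G, Set.mem_iInter.2 fun n => ?_, le_of_forall_gt_imp_ge_of_dense fun c hc =>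
    divergence_le_of_tendsto_eLpNorm hg hG hlim (hgL c hc)⟩
  exact hclosed n (fun i => hanti (Nat.le_add_left n i) (hgC (i + n))) hG
    (hlim.comp (tendsto_add_atTop_nat n))

theorem tendsto_infDivergence_iInter (hanti : Antitone C) (hdens : ∀ g ∈ C 0, IsDensity ν g)
    (hconv : ∀ n, Convex ℝ (C n)) (hclosed : ∀ n, IsL1Closed ν (C n)) :
    Tendsto (fun n => infDivergence ν (C n)) atTop (𝓝 (infDivergence ν (⋂ n, C n))) := by
  have hmono : Monotone fun n => infDivergence ν (C n) := fun _ _ h => infDivergence_anti (hanti h)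
  convert tendsto_atTop_iSup hmono using 2
  refine le_antisymm ?_ (iSup_le fun n => infDivergence_anti (Set.iInter_subset C n))
  by_cases hL : ⨆ n, infDivergence ν (C n) = ∞
  · exact hL ▸ le_top
  · obtain ⟨G, hG, hle⟩ := exists_mem_iInter_divergence_le hanti hdens hconv hclosed hL
    exact (infDivergence_le hG).trans hle

end DecreasingClasses

section WeightedGram

variable {α ι : Type*} [MeasurableSpace α] {ν : Measure α} [Fintype ι] {w : α → ℝ} {φ : α → ι → ℝ}

/-- The Gram matrix `(∫ w φ_i φ_j dν)` of the statistics `φ_j` for the weight `w`; it is the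
derivative of the moments of a density perturbed by `w` times a combination of the `φ_j`. -/
def weightedGram (ν : Measure α) (w : α → ℝ) (φ : α → ι → ℝ) : Matrix ι ι ℝ :=
  Matrix.of fun i j => ∫ x, w x * φ x i * φ x j ∂ν

lemma weightedGram_mulVec (hw : Integrable w ν) (hφ : ∀ j, MemLp (fun x => φ x j) ∞ ν) (θ : ι → ℝ)
    (i : ι) : (weightedGram ν w φ *ᵥ θ) i = ∫ x, w x * (∑ j, θ j * φ x j) * φ x i ∂ν := by
  have hint : ∀ j, Integrable (fun x => w x * φ x i * φ x j) ν := fun j =>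
    (hw.mul_of_top_left (hφ i)).mul_of_top_left (hφ j)
  calc (weightedGram ν w φ *ᵥ θ) i = ∑ j, ∫ x, w x * φ x i * φ x j * θ j ∂ν := by
        simp only [integral_mul_const]; rfl
    _ = ∫ x, ∑ j, w x * φ x i * φ x j * θ j ∂ν :=
        (integral_finsetSum _ fun j _ => (hint j).mul_const (θ j)).symm
    _ = ∫ x, w x * (∑ j, θ j * φ x j) * φ x i ∂ν := by
        refine integral_congr_ae (Eventually.of_forall fun x => ?_)
        simp only [Finset.mul_sum, Finset.sum_mul]
        exact Finset.sum_congr rfl fun j _ => by ring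

lemma memLp_top_sum_mul (hφ : ∀ j, MemLp (fun x => φ x j) ∞ ν) (θ : ι → ℝ) :
    MemLp (fun x => ∑ j, θ j * φ x j) ∞ ν :=
  memLp_finsetSum _ fun j _ => (hφ j).const_mul (θ j)

lemma dotProduct_weightedGram_mulVec (hw : Integrable w ν) (hφ : ∀ j, MemLp (fun x => φ x j) ∞ ν)
    (θ : ι → ℝ) : θ ⬝ᵥ weightedGram ν w φ *ᵥ θ = ∫ x, w x * (∑ j, θ j * φ x j) ^ 2 ∂ν := by
  have hint : ∀ i, Integrable (fun x => w x * (∑ j, θ j * φ x j) * φ x i) ν := fun i =>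
    (hw.mul_of_top_left (memLp_top_sum_mul hφ θ)).mul_of_top_left (hφ i)
  calc θ ⬝ᵥ weightedGram ν w φ *ᵥ θ
      = ∑ i, ∫ x, θ i * (w x * (∑ j, θ j * φ x j) * φ x i) ∂ν := by
        simp only [dotProduct, weightedGram_mulVec hw hφ, integral_const_mul]
    _ = ∫ x, ∑ i, θ i * (w x * (∑ j, θ j * φ x j) * φ x i) ∂ν :=
        (integral_finsetSum _ fun i _ => (hint i).const_mul (θ i)).symm
    _ = ∫ x, w x * (∑ j, θ j * φ x j) ^ 2 ∂ν := by
        refine integral_congr_ae (Eventually.of_forall fun x => ?_)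
        simp only [sq, ← mul_assoc, Finset.mul_sum (s := Finset.univ) (a := w x * _)]
        exact Finset.sum_congr rfl fun i _ => by ring

lemma isUnit_weightedGram [DecidableEq ι] (hw : Integrable w ν) (hw0 : 0 ≤ᵐ[ν] w)
    (hφ : ∀ j, MemLp (fun x => φ x j) ∞ ν)
    (hind : ∀ θ : ι → ℝ, (∀ᵐ x ∂ν, 0 < w x → ∑ j, θ j * φ x j = 0) → θ = 0) :
    IsUnit (weightedGram ν w φ) := by
  rw [← Matrix.mulVec_injective_iff_isUnit]
  refine (injective_iff_map_eq_zero (weightedGram ν w φ).mulVecLin).2 fun θ hθ => hind θ ?_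
  have hzero : ∫ x, w x * (∑ j, θ j * φ x j) ^ 2 ∂ν = 0 := by
    rw [← dotProduct_weightedGram_mulVec hw hφ, ← Matrix.mulVecLin_apply, hθ, dotProduct_zero]
  have hint : Integrable (fun x => w x * (∑ j, θ j * φ x j) ^ 2) ν := by
    simp only [sq, ← mul_assoc]
    exact (hw.mul_of_top_left (memLp_top_sum_mul hφ θ)).mul_of_top_left (memLp_top_sum_mul hφ θ)
  have hnonneg : 0 ≤ᵐ[ν] fun x => w x * (∑ j, θ j * φ x j) ^ 2 :=
    hw0.mono fun x hx => mul_nonneg hx (sq_nonneg _)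
  filter_upwards [(integral_eq_zero_iff_of_nonneg_ae hnonneg hint).1 hzero] with x hx hwx
  exact pow_eq_zero_iff two_ne_zero |>.1 ((mul_eq_zero.1 hx).resolve_left hwx.ne')

lemma eventually_ae_abs_sum_mul_le_one (hφ : ∀ j, MemLp (fun x => φ x j) ∞ ν) :
    ∀ᶠ θ : ι → ℝ in 𝓝 0, ∀ᵐ x ∂ν, |∑ j, θ j * φ x j| ≤ 1 := by
  have hbound : ∀ j, ∃ C : ℝ, ∀ᵐ x ∂ν, |φ x j| ≤ C := fun j =>
    ⟨lpNorm (fun x => φ x j) ∞ ν, ae_le_lpNorm_exponent_top (hφ j)⟩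
  choose C hC using hbound
  have hcont : Continuous fun θ : ι → ℝ => ∑ j, |θ j| * C j := by fun_prop
  have hsmall : ∀ᶠ θ : ι → ℝ in 𝓝 0, ∑ j, |θ j| * C j < 1 :=
    hcont.continuousAt.eventually_lt_const (by simp)
  filter_upwards [hsmall] with θ hθ
  filter_upwards [ae_all_iff.2 hC] with x hx
  calc |∑ j, θ j * φ x j| ≤ ∑ j, |θ j * φ x j| := Finset.abs_sum_le_sum_abs _ _
    _ ≤ ∑ j, |θ j| * C j := Finset.sum_le_sum fun j _ => by
        rw [abs_mul]; exact mul_le_mul_of_nonneg_left (hx j) (abs_nonneg _)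
    _ ≤ 1 := hθ.le

lemma eventually_exists_weightedGram_mulVec_eq (hw : Integrable w ν) (hw0 : 0 ≤ᵐ[ν] w)
    (hφ : ∀ j, MemLp (fun x => φ x j) ∞ ν)
    (hind : ∀ θ : ι → ℝ, (∀ᵐ x ∂ν, 0 < w x → ∑ j, θ j * φ x j = 0) → θ = 0) :
    ∀ᶠ γ : ι → ℝ in 𝓝 0, ∃ θ, weightedGram ν w φ *ᵥ θ = γ ∧ ∀ᵐ x ∂ν, |∑ j, θ j * φ x j| ≤ 1 := by
  classical
  have hdet := (Matrix.isUnit_iff_isUnit_det _).1 (isUnit_weightedGram hw hw0 hφ hind)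
  have hcont : Continuous fun γ : ι → ℝ => (weightedGram ν w φ)⁻¹ *ᵥ γ :=
    Continuous.matrix_mulVec continuous_const continuous_id
  have hlim : Tendsto (fun γ : ι → ℝ => (weightedGram ν w φ)⁻¹ *ᵥ γ) (𝓝 0) (𝓝 0) :=
    hcont.tendsto' _ _ (Matrix.mulVec_zero _)
  filter_upwards [hlim.eventually (eventually_ae_abs_sum_mul_le_one hφ)] with γ hγ
  exact ⟨_, by rw [Matrix.mulVec_mulVec, Matrix.mul_nonsing_inv _ hdet, Matrix.one_mulVec], hγ⟩

end WeightedGram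

section Feasibility

variable {α ι : Type*} [MeasurableSpace α] {ν : Measure α} {φ : α → ι → ℝ}

lemma klFun_le_sq {x : ℝ} (hx : 0 ≤ x) : klFun x ≤ (x - 1) ^ 2 := by
  rcases hx.eq_or_lt with rfl | hx
  · simp [klFun_zero]
  · have := mul_le_mul_of_nonneg_left (Real.log_le_sub_one_of_pos hx) hx.le
    rw [klFun_apply]
    linarith

lemma divergence_ne_top_of_bounded [IsFiniteMeasure ν] {g : α → ℝ} {M : ℝ} (hg0 : 0 ≤ᵐ[ν] g)
    (hgM : ∀ᵐ x ∂ν, g x ≤ M) : divergence ν g ≠ ∞ := by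
  refine ne_top_of_le_ne_top (ENNReal.mul_ne_top ENNReal.ofReal_ne_top (measure_ne_top ν .univ))
    ((lintegral_mono_ae ?_).trans (lintegral_const (ENNReal.ofReal (M ^ 2 + 1))).le)
  filter_upwards [hg0, hgM] with x (hx0 : 0 ≤ g x) hxM
  exact ENNReal.ofReal_le_ofReal ((klFun_le_sq hx0).trans (by nlinarith))

lemma IsDensity.tendsto_integral_min_mul {p f : α → ℝ} (hp : IsDensity ν p) (hf : MemLp f ∞ ν) :
    Tendsto (fun n : ℕ => ∫ x, min (p x) (n + 1) * f x ∂ν) atTop (𝓝 (∫ x, p x * f x ∂ν)) := by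
  refine tendsto_integral_of_dominated_convergence (fun x => |p x * f x|)
    (fun n => (hp.integrable.1.inf aestronglyMeasurable_const).mul hf.1)
    (hp.integrable.mul_of_top_left hf).abs (fun n => ?_) (Eventually.of_forall fun x => ?_)
  · filter_upwards [hp.nonneg] with x (hx : 0 ≤ p x)
    rw [Real.norm_eq_abs, abs_mul, abs_mul, abs_of_nonneg hx,
      abs_of_nonneg (le_min hx (by positivity))]
    exact mul_le_mul_of_nonneg_right (min_le_left _ _) (abs_nonneg _)
  · refine tendsto_const_nhds.congr' ?_
    filter_upwards [eventually_ge_atTop ⌈p x⌉₊] with n hn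
    rw [min_eq_left ((Nat.le_ceil _).trans (by exact_mod_cast hn.trans n.le_succ))]

lemma min_add_min_one_mul_mem_Icc {x c s : ℝ} (hx : 0 ≤ x) (hc : 1 ≤ c) (hs : |s| ≤ 1) :
    min x c + min x 1 * s ∈ Set.Icc 0 (c + 1) := by
  obtain ⟨hs₁, hs₂⟩ := abs_le.1 hs
  have hmin_nonneg : 0 ≤ min x 1 := le_min hx zero_le_one
  have hmin_mono : min x 1 ≤ min x c := min_le_min_left x hc
  have hmin_le : min x c ≤ c := min_le_right x c
  have hmin_one : min x 1 ≤ 1 := min_le_right x 1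
  constructor <;> nlinarith

/- The moments of a truncation `min p n` are close to those of `p`, and the difference is corrected
by a perturbation `min p 1 * ∑ θ_j φ_j` small enough to keep the density nonnegative. -/
theorem eventually_infDivergence_momentClass_ne_top [IsFiniteMeasure ν] [Fintype ι] {p : α → ℝ}
    (hp : IsDensity ν p) (hφ : ∀ j, MemLp (fun x => φ x j) ∞ ν)
    (hind : ∀ θ : ι → ℝ, (∀ᵐ x ∂ν, 0 < p x → ∑ j, θ j * φ x j = 0) → θ = 0)
    {j₀ : ι} (hj₀ : ∀ x, φ x j₀ = 1) :
    ∀ᶠ a : ι → ℝ in 𝓝 fun j => ∫ x, p x * φ x j ∂ν,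
      a j₀ = 1 → infDivergence ν (momentClass ν φ a) ≠ ∞ := by
  have hmin : ∀ c : ℝ, Integrable (fun x => min (p x) c) ν := fun c =>
    hp.integrable.inf (integrable_const c)
  have hsolve := eventually_exists_weightedGram_mulVec_eq (hmin 1)
    (hp.nonneg.mono fun x hx => le_min hx zero_le_one) hφ fun θ hθ => hind θ <|
      hθ.mono fun x hx hpx => hx (lt_min hpx one_pos)
  have hlim : Tendsto (fun an : (ι → ℝ) × ℕ => an.1 - fun j => ∫ x, min (p x) (an.2 + 1) * φ x j ∂ν)
      (𝓝 (fun j => ∫ x, p x * φ x j ∂ν) ×ˢ atTop) (𝓝 0) := by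
    have htrunc : Tendsto (fun (n : ℕ) j => ∫ x, min (p x) (n + 1) * φ x j ∂ν) atTop
        (𝓝 fun j => ∫ x, p x * φ x j ∂ν) :=
      tendsto_pi_nhds.2 fun j => hp.tendsto_integral_min_mul (hφ j)
    exact sub_self (fun j => ∫ x, p x * φ x j ∂ν) ▸ tendsto_fst.sub (htrunc.comp tendsto_snd)
  filter_upwards [(hlim.eventually hsolve).curry] with a ha haj₀
  obtain ⟨n, θ, hθ, hθ1⟩ := ha.exists
  set s : α → ℝ := fun x => ∑ j, θ j * φ x j
  let g : α → ℝ := fun x => min (p x) (n + 1) + min (p x) 1 * s x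
  have hs : MemLp s ∞ ν := memLp_top_sum_mul hφ θ
  have hmoments : ∀ j, ∫ x, g x * φ x j ∂ν = a j := fun j =>
    calc ∫ x, g x * φ x j ∂ν
        = ∫ x, (min (p x) (n + 1) * φ x j + min (p x) 1 * s x * φ x j) ∂ν := by
          simp only [g, add_mul]
      _ = ∫ x, min (p x) (n + 1) * φ x j ∂ν + (weightedGram ν (fun x => min (p x) 1) φ *ᵥ θ) j := by
          rw [weightedGram_mulVec (hmin 1) hφ]
          exact integral_add ((hmin _).mul_of_top_left (hφ j))
            (((hmin 1).mul_of_top_left hs).mul_of_top_left (hφ j))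
      _ = a j := by rw [hθ]; simp
  have hbounds : ∀ᵐ x ∂ν, g x ∈ Set.Icc 0 ((n : ℝ) + 1 + 1) := by
    filter_upwards [hp.nonneg, hθ1] with x hx hsx
    exact min_add_min_one_mul_mem_Icc hx (by simp) hsx
  have hg : IsDensity ν g :=
    ⟨(hmin _).add ((hmin 1).mul_of_top_left hs), hbounds.mono fun x hx => hx.1, by
      simpa only [hj₀, mul_one, haj₀] using hmoments j₀⟩
  exact ne_top_of_le_ne_top (divergence_ne_top_of_bounded hg.nonneg (hbounds.mono fun x hx => hx.2))
    (infDivergence_le ⟨hg, hmoments⟩)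

end Feasibility

section Duality

variable {α : Type*} [MeasurableSpace α] {ν : Measure α} {g p f : α → ℝ}

/-- The functional `f ↦ ∫ p f dν - ∫ (e^f - 1) dν`, whose supremum over bounded functions `f` is the
divergence from `ν` of the law with density `p`. -/
def dualFunctional (ν : Measure α) (p f : α → ℝ) : ℝ :=
  ∫ x, p x * f x ∂ν - ∫ x, (Real.exp (f x) - 1) ∂ν

lemma integrable_exp_of_memLp_top [IsFiniteMeasure ν] (hf : MemLp f ∞ ν) :
    Integrable (fun x => Real.exp (f x)) ν := by
  refine Integrable.of_bound (Real.continuous_exp.comp_aestronglyMeasurable hf.1)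
    (Real.exp (lpNorm f ∞ ν)) ?_
  filter_upwards [ae_le_lpNorm_exponent_top hf] with x hx
  rw [Real.norm_eq_abs, Real.abs_exp]
  exact Real.exp_le_exp.2 ((le_abs_self _).trans hx)

lemma ofReal_dualFunctional_le_divergence [IsFiniteMeasure ν] (hg : Integrable g ν)
    (hg0 : 0 ≤ᵐ[ν] g) (hf : MemLp f ∞ ν) :
    ENNReal.ofReal (dualFunctional ν g f) ≤ divergence ν g := by
  by_cases hfin : divergence ν g = ∞
  · exact hfin ▸ le_top
  have hkl0 : 0 ≤ᵐ[ν] fun x => klFun (g x) := hg0.mono fun x hx => klFun_nonneg hx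
  have hkl : Integrable (fun x => klFun (g x)) ν :=
    (lintegral_ofReal_ne_top_iff_integrable
      (measurable_klFun.comp_aemeasurable hg.1.aemeasurable).aestronglyMeasurable hkl0).1 hfin
  have hexp : Integrable (fun x => Real.exp (f x) - 1) ν :=
    (integrable_exp_of_memLp_top hf).sub (integrable_const 1)
  rw [divergence, ← ofReal_integral_eq_lintegral_ofReal hkl hkl0]
  refine ENNReal.ofReal_le_ofReal (sub_le_iff_le_add.2 ?_)
  rw [← integral_add hkl hexp]
  exact integral_mono_ae (hg.mul_of_top_left hf) (hkl.add hexp)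
    (hg0.mono fun x hx => mul_le_klFun_add_exp_sub_one hx (f x))

lemma klFun_le_mul_log_sub {x c : ℝ} (hc : 0 < c) (h : 0 ≤ (x - c) * Real.log c) :
    klFun c ≤ x * Real.log c - (Real.exp (Real.log c) - 1) := by
  rw [Real.exp_log hc, klFun_apply]
  linarith

lemma sub_mul_log_clamp_nonneg {r : ℝ} (hr : 1 ≤ r) (x : ℝ) :
    0 ≤ (x - max r⁻¹ (min x r)) * Real.log (max r⁻¹ (min x r)) := by
  rcases le_total x r with hxr | hxr
  · rw [min_eq_left hxr]
    rcases le_total r⁻¹ x with hrx | hrx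
    · rw [max_eq_right hrx, sub_self, zero_mul]
    · rw [max_eq_left hrx, Real.log_inv]
      exact mul_nonneg_of_nonpos_of_nonpos (sub_nonpos.2 hrx) (neg_nonpos.2 (Real.log_nonneg hr))
  · rw [min_eq_right hxr, max_eq_right ((inv_le_one_of_one_le₀ hr).trans hr)]
    exact mul_nonneg (sub_nonneg.2 hxr) (Real.log_nonneg hr)

lemma abs_log_clamp_le {r : ℝ} (hr : 1 ≤ r) (x : ℝ) :
    |Real.log (max r⁻¹ (min x r))| ≤ Real.log r := by
  have hr0 : 0 < r⁻¹ := inv_pos.2 (one_pos.trans_le hr)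
  refine abs_le.2 ⟨?_, Real.log_le_log (lt_max_of_lt_left hr0)
    (max_le ((inv_le_one_of_one_le₀ hr).trans hr) (min_le_right x r))⟩
  rw [← Real.log_inv]
  exact Real.log_le_log hr0 (le_max_left _ _)

lemma divergence_clamp_le_ofReal_dualFunctional [IsFiniteMeasure ν] (hp : Integrable p ν)
    {r : ℝ} (hr : 1 ≤ r) :
    divergence ν (fun x => max r⁻¹ (min (p x) r)) ≤
      ENNReal.ofReal (dualFunctional ν p fun x => Real.log (max r⁻¹ (min (p x) r))) := by
  set c : α → ℝ := fun x => max r⁻¹ (min (p x) r)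
  have hc : ∀ x, 0 < c x := fun x => lt_max_of_lt_left (inv_pos.2 (one_pos.trans_le hr))
  have hcm : AEStronglyMeasurable c ν :=
    aestronglyMeasurable_const.sup (hp.1.inf aestronglyMeasurable_const)
  have hlog : MemLp (fun x => Real.log (c x)) ∞ ν :=
    memLp_top_of_bound (Real.measurable_log.comp_aemeasurable hcm.aemeasurable).aestronglyMeasurable
      (Real.log r) (Eventually.of_forall fun x => abs_log_clamp_le hr (p x))
  have hplog : Integrable (fun x => p x * Real.log (c x)) ν := hp.mul_of_top_left hlog
  have hexp : Integrable (fun x => Real.exp (Real.log (c x)) - 1) ν :=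
    (integrable_exp_of_memLp_top hlog).sub (integrable_const 1)
  have hsub : Integrable (fun x => p x * Real.log (c x) - (Real.exp (Real.log (c x)) - 1)) ν :=
    hplog.sub hexp
  have hle : ∀ x, klFun (c x) ≤ p x * Real.log (c x) - (Real.exp (Real.log (c x)) - 1) := fun x =>
    klFun_le_mul_log_sub (hc x) (sub_mul_log_clamp_nonneg hr (p x))
  rw [dualFunctional, ← integral_sub hplog hexp, ofReal_integral_eq_lintegral_ofReal
    hsub (Eventually.of_forall fun x => (klFun_nonneg (hc x).le).trans (hle x))]
  exact lintegral_mono fun x => ENNReal.ofReal_le_ofReal (hle x)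

lemma tendsto_clamp {x : ℝ} (hx : 0 ≤ x) :
    Tendsto (fun n : ℕ => max ((n : ℝ) + 1)⁻¹ (min x (n + 1))) atTop (𝓝 x) := by
  have hmin : Tendsto (fun n : ℕ => min x ((n : ℝ) + 1)) atTop (𝓝 x) := by
    refine tendsto_const_nhds.congr' ?_
    filter_upwards [eventually_ge_atTop ⌈x⌉₊] with n hn
    rw [min_eq_left ((Nat.le_ceil x).trans (by exact_mod_cast hn.trans n.le_succ))]
  simpa only [one_div, max_eq_right hx] using
    (tendsto_one_div_add_atTop_nhds_zero_nat (𝕜 := ℝ)).max hmin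

lemma IsDensity.exists_lt_ofReal_dualFunctional [IsFiniteMeasure ν] (hp : IsDensity ν p) {a : ℝ≥0∞}
    (ha : a < divergence ν p) :
    ∃ f, MemLp f ∞ ν ∧ a < ENNReal.ofReal (dualFunctional ν p f) := by
  set c : ℕ → α → ℝ := fun n x => max ((n : ℝ) + 1)⁻¹ (min (p x) (n + 1))
  have hcm : ∀ n, AEStronglyMeasurable (c n) ν := fun n =>
    aestronglyMeasurable_const.sup (hp.integrable.1.inf aestronglyMeasurable_const)
  have hone : ∀ n : ℕ, (1 : ℝ) ≤ n + 1 := fun n => by simp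
  have hfatou : divergence ν p ≤ liminf (fun n => divergence ν (c n)) atTop :=
    calc divergence ν p = ∫⁻ x, liminf (fun n => ENNReal.ofReal (klFun (c n x))) atTop ∂ν := by
          refine lintegral_congr_ae (hp.nonneg.mono fun x hx => ?_)
          exact (ENNReal.tendsto_ofReal
            ((continuous_klFun.tendsto (p x)).comp (tendsto_clamp hx))).liminf_eq.symm
      _ ≤ liminf (fun n => divergence ν (c n)) atTop :=
          lintegral_liminf_le' fun n => aemeasurable_ofReal_klFun (hcm n)
  obtain ⟨n, hn⟩ := (eventually_lt_of_lt_liminf (ha.trans_le hfatou)).exists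
  refine ⟨fun x => Real.log (c n x), memLp_top_of_bound
    (Real.measurable_log.comp_aemeasurable (hcm n).aemeasurable).aestronglyMeasurable
    (Real.log (n + 1)) (Eventually.of_forall fun x => abs_log_clamp_le (hone n) (p x)), ?_⟩
  exact hn.trans_le (divergence_clamp_le_ofReal_dualFunctional hp.integrable (hone n))

end Duality

section ContinuousDuality

variable {α : Type*} [MeasurableSpace α] {ν : Measure α} [IsFiniteMeasure ν] {p f : α → ℝ}

lemma exists_continuous_tendsto_ae [TopologicalSpace α] [NormalSpace α] [BorelSpace α]
    [ν.WeaklyRegular] (hf : MemLp f ∞ ν) :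
    ∃ (C : ℝ) (h : ℕ → α → ℝ), (∀ n, Continuous (h n)) ∧ (∀ n x, |h n x| ≤ C) ∧
      ∀ᵐ x ∂ν, Tendsto (fun n => h n x) atTop (𝓝 (f x)) := by
  have hf1 : MemLp f 1 ν := hf.mono_exponent le_top
  have happrox : ∀ n : ℕ, ∃ h : α → ℝ, Continuous h ∧ Integrable h ν ∧
      eLpNorm (h - f) 1 ν ≤ (n : ℝ≥0∞)⁻¹ := fun n => by
    obtain ⟨h, hle, hint⟩ := hf1.exists_boundedContinuous_eLpNorm_sub_le ENNReal.one_ne_top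
      (ENNReal.inv_ne_zero.2 (ENNReal.natCast_ne_top n))
    exact ⟨h, h.continuous, memLp_one_iff_integrable.1 hint, eLpNorm_sub_comm f h 1 ν ▸ hle⟩
  choose h hcont hint hle using happrox
  obtain ⟨ns, -, hae⟩ := exists_seq_tendsto_ae_of_tendsto_eLpNorm hint
    (memLp_one_iff_integrable.1 hf1) (tendsto_of_tendsto_of_tendsto_of_le_of_le tendsto_const_nhds
      ENNReal.tendsto_inv_nat_nhds_zero (fun _ => zero_le) hle)
  set C := lpNorm f ∞ ν
  have hC : 0 ≤ C := lpNorm_nonneg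
  refine ⟨C, fun n x => max (-C) (min (h (ns n) x) C),
    fun n => continuous_const.max ((hcont (ns n)).min continuous_const),
    fun n x => abs_le.2 ⟨le_max_left _ _, max_le (neg_le_self hC) (min_le_right _ _)⟩, ?_⟩
  filter_upwards [hae, ae_le_lpNorm_exponent_top hf] with x hx hfx
  obtain ⟨hfx₁, hfx₂⟩ := abs_le.1 hfx
  have hclamp := (tendsto_const_nhds (x := -C)).max (hx.min (tendsto_const_nhds (x := C)))
  rwa [min_eq_left hfx₂, max_eq_right hfx₁] at hclamp

lemma tendsto_dualFunctional (hp : Integrable p ν) {h : ℕ → α → ℝ} {C : ℝ}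
    (hh : ∀ n, AEStronglyMeasurable (h n) ν) (hC : ∀ n x, |h n x| ≤ C)
    (hlim : ∀ᵐ x ∂ν, Tendsto (fun n => h n x) atTop (𝓝 (f x))) :
    Tendsto (fun n => dualFunctional ν p (h n)) atTop (𝓝 (dualFunctional ν p f)) := by
  refine (tendsto_integral_of_dominated_convergence (fun x => |p x| * C)
    (fun n => hp.1.mul (hh n)) (hp.abs.mul_const C) (fun n => Eventually.of_forall fun x => ?_)
    (hlim.mono fun x hx => hx.const_mul (p x))).sub
    (tendsto_integral_of_dominated_convergence (fun _ => Real.exp C + 1)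
    (fun n => (Real.continuous_exp.comp_aestronglyMeasurable (hh n)).sub
      aestronglyMeasurable_const) (integrable_const _)
    (fun n => Eventually.of_forall fun x => ?_)
    (hlim.mono fun x hx => ((Real.continuous_exp.tendsto _).comp hx).sub_const 1))
  · rw [Pi.mul_apply, norm_mul]
    exact mul_le_mul_of_nonneg_left (hC n x) (abs_nonneg _)
  · have hexp := Real.exp_le_exp.2 ((le_abs_self _).trans (hC n x))
    exact (norm_sub_le _ _).trans (by simpa using hexp)

lemma IsDensity.exists_continuous_lt_ofReal_dualFunctional [TopologicalSpace α] [NormalSpace α]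
    [BorelSpace α] [ν.WeaklyRegular] (hp : IsDensity ν p) {a : ℝ≥0∞} (ha : a < divergence ν p) :
    ∃ f, Continuous f ∧ MemLp f ∞ ν ∧ a < ENNReal.ofReal (dualFunctional ν p f) := by
  obtain ⟨f, hf, haf⟩ := hp.exists_lt_ofReal_dualFunctional ha
  obtain ⟨C, h, hcont, hC, hlim⟩ := exists_continuous_tendsto_ae hf
  have hmeas : ∀ n, AEStronglyMeasurable (h n) ν := fun n => (hcont n).aestronglyMeasurable
  obtain ⟨n, hn⟩ := ((ENNReal.tendsto_ofReal (tendsto_dualFunctional hp.integrable hmeas hC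
    hlim)).eventually_const_lt haf).exists
  exact ⟨h n, hcont n, memLp_top_of_bound (hmeas n) C (Eventually.of_forall (hC n)), hn⟩

end ContinuousDuality

section UniformApproximation

variable {α : Type*} [MeasurableSpace α] {ν : Measure α} {g p f s : α → ℝ}

lemma IsDensity.abs_integral_mul_sub_le (hg : IsDensity ν g) (hf : MemLp f ∞ ν) (hs : MemLp s ∞ ν)
    {ε : ℝ} (h : ∀ᵐ x ∂ν, |f x - s x| ≤ ε) :
    |∫ x, g x * f x ∂ν - ∫ x, g x * s x ∂ν| ≤ ε := by
  have hgf : Integrable (fun x => g x * f x) ν := hg.integrable.mul_of_top_left hf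
  have hgs : Integrable (fun x => g x * s x) ν := hg.integrable.mul_of_top_left hs
  rw [← integral_sub hgf hgs]
  have hε : ∫ x, g x * ε ∂ν = ε := by rw [integral_mul_const, hg.integral_eq_one, one_mul]
  have hle : ∀ᵐ x ∂ν, ‖g x * f x - g x * s x‖ ≤ g x * ε := by
    filter_upwards [h, hg.nonneg] with x hx (hgx : 0 ≤ g x)
    rw [← mul_sub, norm_mul, Real.norm_of_nonneg hgx]
    exact mul_le_mul_of_nonneg_left hx hgx
  exact (norm_integral_le_of_norm_le (hg.integrable.mul_const ε) hle).trans hε.le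

lemma dualFunctional_sub_le (hg : IsDensity ν g) (hp : IsDensity ν p) (hf : MemLp f ∞ ν)
    (hs : MemLp s ∞ ν) {ε : ℝ} (h : ∀ᵐ x ∂ν, |f x - s x| ≤ ε)
    (hgp : ∫ x, g x * s x ∂ν = ∫ x, p x * s x ∂ν) :
    dualFunctional ν p f - 2 * ε ≤ dualFunctional ν g f := by
  have hgf := (abs_le.1 (hg.abs_integral_mul_sub_le hf hs h)).1
  have hpf := (abs_le.1 (hp.abs_integral_mul_sub_le hf hs h)).2
  unfold dualFunctional
  linarith

lemma integral_mul_sum_mul {ι : Type*} [Fintype ι] {φ : α → ι → ℝ} {a : ι → ℝ}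
    (hφ : ∀ j, MemLp (fun x => φ x j) ∞ ν) (hg : g ∈ momentClass ν φ a) (θ : ι → ℝ) :
    ∫ x, g x * ∑ j, θ j * φ x j ∂ν = ∑ j, θ j * a j := by
  have hint : ∀ j, Integrable (fun x => θ j * (g x * φ x j)) ν := fun j =>
    (hg.1.integrable.mul_of_top_left (hφ j)).const_mul (θ j)
  calc ∫ x, g x * ∑ j, θ j * φ x j ∂ν = ∫ x, ∑ j, θ j * (g x * φ x j) ∂ν := by
        simp only [Finset.mul_sum, mul_left_comm]
    _ = ∑ j, θ j * a j := by
        simp only [integral_finsetSum _ fun j _ => hint j, integral_const_mul, hg.2]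

theorem tendsto_infDivergence_momentClass_of_approx [TopologicalSpace α] [NormalSpace α]
    [BorelSpace α] [IsFiniteMeasure ν] [ν.WeaklyRegular] {ι : ℕ → Type*} [∀ m, Fintype (ι m)]
    {φ : (m : ℕ) → α → ι m → ℝ} (hφ : ∀ m j, MemLp (fun x => φ m x j) ∞ ν)
    (happrox : ∀ f : α → ℝ, Continuous f → ∀ ε > 0, ∀ᶠ m in atTop, ∃ θ : ι m → ℝ,
      ∀ᵐ x ∂ν, |f x - ∑ j, θ j * φ m x j| ≤ ε)
    (hp : IsDensity ν p) :
    Tendsto (fun m => infDivergence ν (momentClass ν (φ m) fun j => ∫ x, p x * φ m x j ∂ν)) atTop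
      (𝓝 (divergence ν p)) := by
  have hmem : ∀ m, p ∈ momentClass ν (φ m) fun j => ∫ x, p x * φ m x j ∂ν := fun m =>
    ⟨hp, fun _ => rfl⟩
  refine tendsto_order.2 ⟨fun a ha => ?_, fun a ha =>
    Eventually.of_forall fun m => (infDivergence_le (hmem m)).trans_lt ha⟩
  obtain ⟨f, hfc, hf, haf⟩ := hp.exists_continuous_lt_ofReal_dualFunctional ha
  have hcont : Continuous fun ε : ℝ => ENNReal.ofReal (dualFunctional ν p f - 2 * ε) :=
    ENNReal.continuous_ofReal.comp (by fun_prop)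
  have hsmall : ∀ᶠ ε : ℝ in 𝓝 0, a < ENNReal.ofReal (dualFunctional ν p f - 2 * ε) :=
    hcont.continuousAt.eventually_const_lt (by simpa using haf)
  obtain ⟨ε, haε, hε : 0 < ε⟩ :=
    ((hsmall.filter_mono nhdsWithin_le_nhds).and (self_mem_nhdsWithin (s := Set.Ioi 0))).exists
  filter_upwards [happrox f hfc ε hε] with m ⟨θ, hθ⟩
  refine haε.trans_le (le_iInf₂ fun g hg => ?_)
  have hgp := (integral_mul_sum_mul (hφ m) hg θ).trans (integral_mul_sum_mul (hφ m) (hmem m) θ).symm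
  exact (ENNReal.ofReal_le_ofReal
    (dualFunctional_sub_le hg.1 hp hf (memLp_top_sum_mul (hφ m) θ) hθ hgp)).trans
    (ofReal_dualFunctional_le_divergence hg.1.integrable hg.1.nonneg hf)

end UniformApproximation

section NegMulLog

variable {α : Type*} {mα : MeasurableSpace α} {ν : Measure α} {g : α → ℝ}

lemma ofReal_klFun_add {x : ℝ} (hx : 0 ≤ x) :
    ENNReal.ofReal (klFun x) + ENNReal.ofReal (Real.negMulLog x) + ENNReal.ofReal x =
      1 + ENNReal.ofReal (-Real.negMulLog x) := by
  have hkl : klFun x = -Real.negMulLog x + 1 - x := by rw [klFun, Real.negMulLog]; ring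
  have hnn := klFun_nonneg hx
  rcases le_total 0 (Real.negMulLog x) with h | h
  · rw [ENNReal.ofReal_of_nonpos (neg_nonpos.2 h), add_zero, ← ENNReal.ofReal_add hnn h,
      ← ENNReal.ofReal_add (add_nonneg hnn h) hx, hkl, ← ENNReal.ofReal_one]
    ring_nf
  · rw [ENNReal.ofReal_of_nonpos h, add_zero, ← ENNReal.ofReal_add hnn hx, ← ENNReal.ofReal_one,
      ← ENNReal.ofReal_add zero_le_one (neg_nonneg.2 h), hkl]
    ring_nf

lemma coe_ennreal_sub_add {a b : ℝ≥0∞} (ha : a ≠ ∞) :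
    (a : EReal) - ((b + a : ℝ≥0∞) : EReal) = -(b : EReal) := by
  have h : ((b : EReal) + a) - a = b := by
    lift a to NNReal using ha
    exact EReal.add_sub_cancel_right (b := (a : ℝ))
  rw [EReal.coe_ennreal_add, sub_eq_add_neg, add_comm, ← EReal.neg_sub, h] <;> simp [ha]

theorem IsDensity.lintegral_negMulLog_sub [IsProbabilityMeasure ν] (hg : IsDensity ν g) :
    ((∫⁻ x, ENNReal.ofReal (Real.negMulLog (g x)) ∂ν : ℝ≥0∞) : EReal) -
      ((∫⁻ x, ENNReal.ofReal (-Real.negMulLog (g x)) ∂ν : ℝ≥0∞) : EReal) =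
      -((divergence ν g : ℝ≥0∞) : EReal) := by
  have hlog : AEMeasurable (fun x => Real.negMulLog (g x)) ν :=
    Real.continuous_negMulLog.measurable.comp_aemeasurable
      hg.integrable.aestronglyMeasurable.aemeasurable
  set A := ∫⁻ x, ENNReal.ofReal (Real.negMulLog (g x)) ∂ν
  set B := ∫⁻ x, ENNReal.ofReal (-Real.negMulLog (g x)) ∂ν
  have hsum : divergence ν g + A + 1 = 1 + B := by
    calc divergence ν g + A + 1
        = ∫⁻ x, ENNReal.ofReal (klFun (g x)) + ENNReal.ofReal (Real.negMulLog (g x)) +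
            ENNReal.ofReal (g x) ∂ν := by
          rw [lintegral_add_right' _ hg.aemeasurable_ofReal,
            lintegral_add_right' _ hlog.ennreal_ofReal, hg.lintegral_eq_one, divergence]
      _ = ∫⁻ x, 1 + ENNReal.ofReal (-Real.negMulLog (g x)) ∂ν :=
          lintegral_congr_ae (hg.nonneg.mono fun x hx => ofReal_klFun_add hx)
      _ = 1 + B := by rw [lintegral_add_left measurable_const, lintegral_one, measure_univ]
  have hAtop : A ≠ ∞ := by
    refine ne_top_of_le_ne_top ENNReal.one_ne_top ?_
    calc A ≤ ∫⁻ _, 1 ∂ν := lintegral_mono_ae ?_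
      _ = 1 := by rw [lintegral_one, measure_univ]
    filter_upwards [hg.nonneg] with x (hx : 0 ≤ g x)
    rw [← ENNReal.ofReal_one]
    refine ENNReal.ofReal_le_ofReal ?_
    have := klFun_nonneg hx
    rw [klFun] at this
    rw [Real.negMulLog]
    linarith
  have hDA : divergence ν g + A = B := by
    rw [add_comm 1] at hsum
    exact (ENNReal.add_left_inj ENNReal.one_ne_top).1 hsum
  rw [← hDA, coe_ennreal_sub_add hAtop]

end NegMulLog

section CubeLaw

variable {d : ℕ}

lemma measurableSet_cube : MeasurableSet (cube d) := measurableSet_Icc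

lemma volume_cube : volume (cube d) = 1 := by simp [cube, Real.volume_Icc_pi]

/-- The uniform distribution on the unit cube: the reference measure with respect to which
densities of cube laws are taken. -/
abbrev uniformCube (d : ℕ) : Measure (Fin d → ℝ) := volume.restrict (cube d)

instance : IsProbabilityMeasure (uniformCube d) :=
  ⟨by rw [Measure.restrict_apply_univ, volume_cube]⟩

lemma ae_mem_cube : ∀ᵐ u ∂uniformCube d, u ∈ cube d := ae_restrict_mem measurableSet_cube

/-- The distribution on the cube with density `g`. -/
def cubeLaw (g : (Fin d → ℝ) → ℝ) : Measure (Fin d → ℝ) :=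
  (uniformCube d).withDensity fun u => ENNReal.ofReal (g u)

variable {g : (Fin d → ℝ) → ℝ}

lemma IsDensity.isCubeLaw (hg : IsDensity (uniformCube d) g) : IsCubeLaw (cubeLaw g) where
  prob := ⟨by rw [cubeLaw, withDensity_apply _ .univ, setLIntegral_univ, hg.lintegral_eq_one]⟩
  hasPDF :=
    (withDensity_absolutelyContinuous _ _).trans Measure.restrict_le_self.absolutelyContinuous
  supp := withDensity_absolutelyContinuous _ _ ae_mem_cube

lemma IsDensity.integral_cubeLaw (hg : IsDensity (uniformCube d) g) (f : (Fin d → ℝ) → ℝ) :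
    ∫ u, f u ∂cubeLaw g = ∫ u, g u * f u ∂uniformCube d := by
  rw [cubeLaw, integral_withDensity_eq_integral_toReal_smul₀ hg.aemeasurable_ofReal (by simp)]
  refine integral_congr_ae (hg.nonneg.mono fun u hu => ?_)
  simp only [ENNReal.toReal_ofReal hu, smul_eq_mul]

lemma IsCubeLaw.exists_density {P : Measure (Fin d → ℝ)} (hP : IsCubeLaw P) :
    ∃ g, IsDensity (uniformCube d) g ∧ cubeLaw g = P := by
  have := hP.prob
  have hac : P ≪ uniformCube d := by
    rw [← Measure.restrict_eq_self_of_ae_mem (show ∀ᵐ u ∂P, u ∈ cube d from hP.supp)]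
    exact hP.hasPDF.restrict _
  refine ⟨fun u => (P.rnDeriv (uniformCube d) u).toReal, ⟨Measure.integrable_toReal_rnDeriv,
    Eventually.of_forall fun _ => ENNReal.toReal_nonneg, ?_⟩, ?_⟩
  · rw [Measure.integral_toReal_rnDeriv hac, probReal_univ]
  · rw [cubeLaw, withDensity_congr_ae
      ((P.rnDeriv_ne_top _).mono fun _ => ENNReal.ofReal_toReal),
      Measure.withDensity_rnDeriv_eq _ _ hac]

lemma IsDensity.lintegral_comp_rnDeriv (hg : IsDensity (uniformCube d) g) {F : ℝ → ℝ≥0∞}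
    (hF : F 0 = 0) :
    ∫⁻ u, F ((cubeLaw g).rnDeriv volume u).toReal = ∫⁻ u, F (g u) ∂uniformCube d := by
  have hrn : (cubeLaw g).rnDeriv volume =ᵐ[volume]
      (cube d).indicator fun u => ENNReal.ofReal (g u) := by
    rw [cubeLaw, ← withDensity_indicator measurableSet_cube]
    exact Measure.rnDeriv_withDensity₀ _
      ((aemeasurable_indicator_iff measurableSet_cube).2 hg.aemeasurable_ofReal)
  have hg₀ := (ae_restrict_iff' measurableSet_cube).1 hg.nonneg
  rw [← lintegral_indicator measurableSet_cube]
  refine lintegral_congr_ae ?_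
  filter_upwards [hrn, hg₀] with u hu hnn
  by_cases hc : u ∈ cube d
  · rw [hu, Set.indicator_of_mem hc, Set.indicator_of_mem hc, ENNReal.toReal_ofReal (hnn hc)]
  · rw [hu, Set.indicator_of_notMem hc, Set.indicator_of_notMem hc, ENNReal.toReal_zero, hF]

theorem IsDensity.diffEntropy_cubeLaw (hg : IsDensity (uniformCube d) g) :
    diffEntropy (cubeLaw g) = -((divergence (uniformCube d) g : ℝ≥0∞) : EReal) := by
  rw [diffEntropy, hg.lintegral_comp_rnDeriv (F := fun x => ENNReal.ofReal (Real.negMulLog x)),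
    hg.lintegral_comp_rnDeriv (F := fun x => ENNReal.ofReal (-Real.negMulLog x)),
    hg.lintegral_negMulLog_sub] <;> simp

lemma continuous_neg_coe_ennreal : Continuous fun x : ℝ≥0∞ => -(x : EReal) :=
  continuous_neg.comp continuous_coe_ennreal_ereal

theorem sSup_diffEntropy_cubeLaw {C : Set ((Fin d → ℝ) → ℝ)}
    (hC : ∀ g ∈ C, IsDensity (uniformCube d) g) :
    sSup ((fun g => diffEntropy (cubeLaw g)) '' C) =
      -((infDivergence (uniformCube d) C : ℝ≥0∞) : EReal) := by
  have hanti : Antitone fun x : ℝ≥0∞ => -(x : EReal) := fun x y hxy =>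
    EReal.neg_le_neg_iff.2 (EReal.coe_ennreal_le_coe_ennreal_iff.2 hxy)
  rw [infDivergence, ← sInf_image,
    hanti.map_sInf_of_continuousAt continuous_neg_coe_ennreal.continuousAt (by simp),
    Set.image_image]
  exact congrArg sSup (Set.image_congr fun g hg => (hC g hg).diffEntropy_cubeLaw)

lemma mem_image_cubeLaw_momentClass {ι : Type*} {φ : (Fin d → ℝ) → ι → ℝ} {a : ι → ℝ}
    {P : Measure (Fin d → ℝ)} :
    P ∈ cubeLaw '' momentClass (uniformCube d) φ a ↔ IsCubeLaw P ∧ expect P φ = a := by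
  constructor
  · rintro ⟨g, hg, rfl⟩
    exact ⟨hg.1.isCubeLaw, funext fun j => (hg.1.integral_cubeLaw _).trans (hg.2 j)⟩
  · rintro ⟨hP, rfl⟩
    obtain ⟨g, hg, rfl⟩ := hP.exists_density
    exact ⟨g, ⟨hg, fun j => (hg.integral_cubeLaw _).symm⟩, rfl⟩

theorem amind_eq_neg_infDivergence {ι : Type*} (φ : (Fin d → ℝ) → ι → ℝ) (a : ι → ℝ) :
    amind φ a = -((infDivergence (uniformCube d) (momentClass (uniformCube d) φ a) : ℝ≥0∞) :
      EReal) := by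
  rw [← sSup_diffEntropy_cubeLaw fun g hg => hg.1, amind]
  refine congrArg sSup (Set.ext fun h => ?_)
  rw [← Set.image_image diffEntropy cubeLaw]
  simp only [Set.mem_image (f := diffEntropy), mem_image_cubeLaw_momentClass, and_assoc,
    eq_comm (a := h), Set.mem_ofPred_eq]

end CubeLaw

section ProbabilityIntegralTransform

variable {ν : Measure ℝ} [IsProbabilityMeasure ν]

lemma nullSingletonClass_of_map {α β : Type*} {mα : MeasurableSpace α} {mβ : MeasurableSpace β}
    [MeasurableSingletonClass β] {ρ : Measure α} {f : α → β} (hf : Measurable f)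
    [NullSingletonClass (ρ.map f)] : NullSingletonClass ρ where
  measure_singleton x := by
    refine measure_mono_null (t := f ⁻¹' {f x}) (by rintro _ rfl; rfl) ?_
    rw [← Measure.map_apply hf (measurableSet_singleton _), measure_singleton]

lemma continuous_cdf [NullSingletonClass ν] : Continuous (cdf ν) := by
  refine continuous_iff_continuousAt.2 fun x => ?_
  have hjump := (cdf ν).measure_singleton x
  rw [measure_cdf, measure_singleton, eq_comm, ENNReal.ofReal_eq_zero] at hjump
  rw [(monotone_cdf ν).continuousAt_iff_leftLim_eq_rightLim, (cdf ν).rightLim_eq]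
  exact le_antisymm ((monotone_cdf ν).leftLim_le le_rfl) (sub_nonpos.1 hjump)

lemma exists_cdf_eq [NullSingletonClass ν] {t : ℝ} (h0 : 0 < t) (h1 : t < 1) :
    ∃ x, cdf ν x = t := by
  obtain ⟨a, ha⟩ := ((tendsto_cdf_atBot ν).eventually_lt_const h0).exists
  obtain ⟨b, hb⟩ := ((tendsto_cdf_atTop ν).eventually_const_lt h1).exists
  exact mem_range_of_exists_le_of_exists_ge continuous_cdf ⟨a, ha.le⟩ ⟨b, hb.le⟩

lemma measureReal_cdf_le [NullSingletonClass ν] {t : ℝ} (h0 : 0 ≤ t) (h1 : t ≤ 1) :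
    ν.real (cdf ν ⁻¹' Set.Iic t) = t := by
  refine le_antisymm (le_of_forall_gt_imp_ge_of_dense fun s hs => ?_)
    (le_of_forall_lt_imp_le_of_dense fun s hs => ?_)
  · rcases le_or_gt 1 s with h | h
    · exact measureReal_le_one.trans h
    · obtain ⟨x, rfl⟩ := exists_cdf_eq (ν := ν) (h0.trans_lt hs) h
      rw [cdf_eq_real]
      exact measureReal_mono fun y hy => ((monotone_cdf ν).reflect_lt (lt_of_le_of_lt hy hs)).le
  · rcases le_or_gt s 0 with h | h
    · exact h.trans measureReal_nonneg
    · obtain ⟨x, rfl⟩ := exists_cdf_eq (ν := ν) h (hs.trans_le h1)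
      rw [cdf_eq_real]
      exact measureReal_mono fun y hy => (monotone_cdf ν hy).trans hs.le

theorem map_cdf_eq_uniform [NullSingletonClass ν] :
    ν.map (cdf ν) = volume.restrict (Set.Icc (0 : ℝ) 1) := by
  have hF : Measurable (cdf ν) := (monotone_cdf ν).measurable
  have := Measure.isProbabilityMeasure_map (μ := ν) hF.aemeasurable
  refine Measure.ext_of_Iic _ _ fun t => ?_
  rw [Measure.map_apply hF measurableSet_Iic, Measure.restrict_apply measurableSet_Iic,
    Set.inter_comm, ← Set.Ici_inter_Iic, Set.inter_assoc, Set.Iic_inter_Iic, Set.Ici_inter_Iic,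
    Real.volume_Icc, sub_zero]
  rcases lt_or_ge t 0 with h0 | h0
  · have hempty : cdf ν ⁻¹' Set.Iic t = ∅ :=
      Set.eq_empty_of_forall_notMem fun x hx => (h0.trans_le (cdf_nonneg ν x)).not_ge hx
    rw [hempty, measure_empty, ENNReal.ofReal_of_nonpos (inf_le_right.trans h0.le)]
  rcases le_total t 1 with h1 | h1
  · rw [inf_eq_right.2 h1, ← ofReal_measureReal, measureReal_cdf_le h0 h1]
  · have huniv : cdf ν ⁻¹' Set.Iic t = Set.univ :=
      Set.eq_univ_of_forall fun x => (cdf_le_one ν x).trans h1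
    rw [huniv, measure_univ, inf_eq_left.2 h1, ENNReal.ofReal_one]

end ProbabilityIntegralTransform

section Moments

lemma integrable_of_continuous_of_ae_mem {α : Type*} [TopologicalSpace α] [T2Space α]
    [MeasurableSpace α] [BorelSpace α] {μ : Measure α} [IsFiniteMeasure μ] {K : Set α}
    (hK : IsCompact K) (hμ : ∀ᵐ x ∂μ, x ∈ K) {f : α → ℝ} (hf : Continuous f) :
    Integrable f μ := by
  rw [← Measure.restrict_eq_self_of_ae_mem hμ]
  exact hf.continuousOn.integrableOn_compact hK

variable {a b : ℝ} {μ ν : Measure ℝ} [IsFiniteMeasure μ] [IsFiniteMeasure ν]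

lemma tendsto_integral_of_abs_sub_lt (hμ : ∀ᵐ x ∂μ, x ∈ Set.Icc a b) {f : ℝ → ℝ}
    (hf : Continuous f) {p : ℕ → ℝ → ℝ} (hp : ∀ n, Continuous (p n))
    (hpf : ∀ n : ℕ, ∀ x ∈ Set.Icc a b, |p n x - f x| < 1 / ((n : ℝ) + 1)) :
    Tendsto (fun n => ∫ x, p n x ∂μ) atTop (𝓝 (∫ x, f x ∂μ)) := by
  refine tendsto_integral_of_dominated_convergence (fun x => |f x| + 1)
    (fun n => (hp n).aestronglyMeasurable)
    (integrable_of_continuous_of_ae_mem isCompact_Icc hμ (by fun_prop)) (fun n => ?_) ?_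
  · filter_upwards [hμ] with x hx
    have hle : 1 / ((n : ℝ) + 1) ≤ 1 := (div_le_one (by positivity)).2 (by simp)
    have := abs_sub_abs_le_abs_sub (p n x) (f x)
    rw [Real.norm_eq_abs]
    linarith [hpf n x hx]
  · filter_upwards [hμ] with x hx
    exact tendsto_iff_dist_tendsto_zero.2 (squeeze_zero (fun _ => dist_nonneg)
      (fun n => (hpf n x hx).le) tendsto_one_div_add_atTop_nhds_zero_nat)

theorem eq_of_forall_integral_pow_eq (hμ : ∀ᵐ x ∂μ, x ∈ Set.Icc a b)
    (hν : ∀ᵐ x ∂ν, x ∈ Set.Icc a b) (h : ∀ n : ℕ, ∫ x, x ^ n ∂μ = ∫ x, x ^ n ∂ν) : μ = ν := by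
  have hpoly : ∀ p : Polynomial ℝ, ∫ x, p.eval x ∂μ = ∫ x, p.eval x ∂ν := fun p => by
    simp only [Polynomial.eval_eq_sum_range]
    rw [integral_finsetSum _ fun i _ =>
        integrable_of_continuous_of_ae_mem isCompact_Icc hμ (by fun_prop),
      integral_finsetSum _ fun i _ =>
        integrable_of_continuous_of_ae_mem isCompact_Icc hν (by fun_prop)]
    simp only [integral_const_mul, h]
  refine ext_of_forall_integral_eq_of_IsFiniteMeasure fun f => ?_
  choose p hp using fun n : ℕ => exists_polynomial_near_of_continuousOn a b f
    f.continuous.continuousOn (1 / ((n : ℝ) + 1)) (by positivity)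
  have hlim := tendsto_integral_of_abs_sub_lt hμ f.continuous (fun n => (p n).continuous) hp
  simp only [hpoly] at hlim
  exact tendsto_nhds_unique hlim
    (tendsto_integral_of_abs_sub_lt hν f.continuous (fun n => (p n).continuous) hp)

end Moments

section Copula

variable {d : ℕ} {P : Measure (Fin d → ℝ)}

lemma isCopulaLaw_dualRep {Ω : Type*} [MeasurableSpace Ω] {μ : Measure Ω} [IsProbabilityMeasure μ]
    {z : Ω → Fin d → ℝ} (hz : Measurable z) (hpdf : μ.map (dualRep μ z) ≪ volume) :
    IsCopulaLaw (μ.map (dualRep μ z)) := by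
  have hzi : ∀ i, Measurable fun ω => z ω i := fun i => (measurable_pi_apply i).comp hz
  have hdual : Measurable (dualRep μ z) :=
    measurable_pi_lambda _ fun i => (monotone_cdf _).measurable.comp (hzi i)
  refine ⟨⟨Measure.isProbabilityMeasure_map hdual.aemeasurable, hpdf, ?_⟩, fun i => ?_⟩
  · refine (ae_map_iff hdual.aemeasurable measurableSet_cube).2 (Eventually.of_forall fun ω => ?_)
    exact ⟨fun i => cdf_nonneg _ _, fun i => cdf_le_one _ _⟩
  · set ν := μ.map fun ω => z ω i
    have hν : IsProbabilityMeasure ν := Measure.isProbabilityMeasure_map (hzi i).aemeasurable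
    have hmarginal : (μ.map (dualRep μ z)).map (fun u => u i) = ν.map (cdf ν) := by
      rw [Measure.map_map (measurable_pi_apply i) hdual,
        Measure.map_map (monotone_cdf _).measurable (hzi i)]
      rfl
    have hac : ν.map (cdf ν) ≪ volume := hmarginal ▸
      (hpdf.map (measurable_pi_apply i)).trans (Measure.quasiMeasurePreserving_eval
        (fun _ : Fin d => (volume : Measure ℝ)) i).absolutelyContinuous
    have : NullSingletonClass (ν.map (cdf ν)) := ⟨fun x => hac (measure_singleton x)⟩
    have := nullSingletonClass_of_map (ρ := ν) (monotone_cdf ν).measurable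
    rw [hmarginal, map_cdf_eq_uniform]

lemma setIntegral_Icc_pow_succ (n : ℕ) :
    ∫ x in Set.Icc (0 : ℝ) 1, x ^ (n + 1) = 1 / (1 + ((n + 1 : ℕ) : ℝ)) := by
  rw [integral_Icc_eq_integral_Ioc, ← intervalIntegral.integral_of_le zero_le_one, integral_pow]
  simp [add_comm]

lemma IsCubeLaw.isCopulaLaw_iff (hP : IsCubeLaw P) :
    IsCopulaLaw P ↔ ∀ i, ∀ n : ℕ, ∫ u, u i ^ (n + 1) ∂P = 1 / (1 + ((n + 1 : ℕ) : ℝ)) := by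
  have := hP.prob
  have hmeas : ∀ i, Measurable fun u : Fin d → ℝ => u i := measurable_pi_apply
  have hmap : ∀ i n, ∫ x, x ^ n ∂P.map (fun u => u i) = ∫ u, u i ^ n ∂P := fun i n =>
    integral_map (hmeas i).aemeasurable (by fun_prop)
  refine ⟨fun h i n => ?_, fun h => ⟨hP, fun i => ?_⟩⟩
  · rw [← hmap, h.uniform_marginals, setIntegral_Icc_pow_succ]
  · have hprob : IsProbabilityMeasure (P.map fun u => u i) :=
      Measure.isProbabilityMeasure_map (hmeas i).aemeasurable
    have hsupp : ∀ᵐ u ∂P, u ∈ cube d := hP.supp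
    refine eq_of_forall_integral_pow_eq (a := 0) (b := 1) ?_ (ae_restrict_mem measurableSet_Icc) ?_
    · exact (ae_map_iff (hmeas i).aemeasurable measurableSet_Icc).2
        (hsupp.mono fun u hu => ⟨hu.1 i, hu.2 i⟩)
    · rintro (_ | n)
      · simp
      · rw [hmap, h, setIntegral_Icc_pow_succ]

end Copula

section ConvexFunctions

variable {ι E : Type*} [NormedAddCommGroup E] [NormedSpace ℝ E]

/- Convex functions with a common bound near `x₀` are equi-Lipschitz near `x₀`, so pointwise
convergence at `x₀` is enough. -/
lemma tendsto_prod_nhds_of_convexOn {l : Filter ι} {f : ι → E → ℝ} {x₀ : E} {r C a : ℝ}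
    (hr : 0 < r) (hf : ∀ i, ConvexOn ℝ (Metric.ball x₀ r) (f i))
    (hC : ∀ i x, dist x x₀ < r → |f i x| ≤ C) (ha : Tendsto (fun i => f i x₀) l (𝓝 a)) :
    Tendsto (fun p : ι × E => f p.1 p.2) (l ×ˢ 𝓝 x₀) (𝓝 a) := by
  have hlip := fun i => (hf i).lipschitzOnWith_of_abs_le (half_pos hr) (hC i)
  have hr' : 0 < r - r / 2 := by linarith
  have hdist : Tendsto (fun p : ι × E => (2 * C / (r / 2)).toNNReal * dist p.2 x₀)
      (l ×ˢ 𝓝 x₀) (𝓝 0) := by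
    simpa using (tendsto_iff_dist_tendsto_zero.1 tendsto_snd).const_mul
      (((2 * C / (r / 2)).toNNReal : ℝ))
  have hdiff : Tendsto (fun p : ι × E => f p.1 p.2 - f p.1 x₀) (l ×ˢ 𝓝 x₀) (𝓝 0) := by
    refine squeeze_zero_norm' ?_ hdist
    filter_upwards [tendsto_snd.eventually (Metric.ball_mem_nhds x₀ hr')] with p hp
    exact (hlip p.1).dist_le_mul p.2 hp x₀ (Metric.mem_ball_self hr')
  simpa using hdiff.add (ha.comp tendsto_fst)

end ConvexFunctions

section Stability

variable {α E : Type*} [MeasurableSpace α] {ν : Measure α} [NormedAddCommGroup E]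
  [NormedSpace ℝ E] [FiniteDimensional ℝ E] {x₀ : E}

lemma IsConvexFamily.continuousAt_infDivergence {C : E → Set (α → ℝ)} (hC : IsConvexFamily ν C)
    (hfin : ∀ᶠ x in 𝓝 x₀, infDivergence ν (C x) ≠ ∞) :
    ContinuousAt (fun x => infDivergence ν (C x)) x₀ := by
  obtain ⟨r, hr, hball⟩ := Metric.eventually_nhds_iff_ball.1 hfin
  have hcont := ((hC.convexOn_toReal_infDivergence (convex_ball x₀ r) hball).continuousOn
    Metric.isOpen_ball).continuousAt (Metric.ball_mem_nhds x₀ hr)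
  refine (ENNReal.continuous_ofReal.continuousAt.comp hcont).congr ?_
  filter_upwards [hfin] with x hx
  exact ENNReal.ofReal_toReal hx

theorem tendsto_infDivergence_prod_nhds {C : ℕ → E → Set (α → ℝ)}
    (hC : ∀ n, IsConvexFamily ν (C n)) (hclosed : ∀ n x, IsL1Closed ν (C n x))
    (hanti : ∀ x, Antitone fun n => C n x)
    (hfin : ∀ᶠ x in 𝓝 x₀, infDivergence ν (⋂ n, C n x) ≠ ∞) :
    Tendsto (fun p : ℕ × E => infDivergence ν (C p.1 p.2)) (atTop ×ˢ 𝓝 x₀)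
      (𝓝 (infDivergence ν (⋂ n, C n x₀))) := by
  have hle : ∀ n x, infDivergence ν (C n x) ≤ infDivergence ν (⋂ n, C n x) := fun n x =>
    infDivergence_anti (Set.iInter_subset _ n)
  obtain ⟨c, hc, hc_top⟩ := ENNReal.lt_iff_exists_nnreal_btwn.1 hfin.self_of_nhds.lt_top
  obtain ⟨r, hr, hball⟩ := Metric.eventually_nhds_iff_ball.1
    (((IsConvexFamily.iInter hC).continuousAt_infDivergence hfin).eventually_lt_const hc)
  have hbound : ∀ n, ∀ x ∈ Metric.ball x₀ r, infDivergence ν (C n x) ≤ c := fun n x hx =>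
    (hle n x).trans (hball x hx).le
  have hne_top : ∀ n, ∀ x ∈ Metric.ball x₀ r, infDivergence ν (C n x) ≠ ∞ := fun n x hx =>
    ((hbound n x hx).trans_lt hc_top).ne
  have hlim : Tendsto (fun n => (infDivergence ν (C n x₀)).toReal) atTop
      (𝓝 (infDivergence ν (⋂ n, C n x₀)).toReal) :=
    (ENNReal.tendsto_toReal hfin.self_of_nhds).comp (tendsto_infDivergence_iInter (hanti x₀)
      ((hC 0).isDensity x₀) (fun n => (hC n).convex x₀) (hclosed · x₀))
  have hprod := tendsto_prod_nhds_of_convexOn hr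
    (fun n => (hC n).convexOn_toReal_infDivergence (convex_ball x₀ r) (hne_top n))
    (C := c) (fun n x hx => by
      rw [abs_of_nonneg ENNReal.toReal_nonneg]
      exact ENNReal.toReal_mono ENNReal.coe_ne_top (hbound n x hx)) hlim
  have hofReal := (ENNReal.continuous_ofReal.tendsto _).comp hprod
  rw [ENNReal.ofReal_toReal hfin.self_of_nhds] at hofReal
  refine hofReal.congr' ?_
  filter_upwards [tendsto_snd.eventually (Metric.ball_mem_nhds x₀ hr)] with p hp
  exact ENNReal.ofReal_toReal (hne_top p.1 p.2 hp)

end Stability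

section RelaxedClass

variable {d q : ℕ} {ψ : (Fin d → ℝ) → Fin q → ℝ} {b : Fin q → ℝ} {g : (Fin d → ℝ) → ℝ}

/-- The densities of the distributions admissible for the relaxed problem `hAM k ψ b`. -/
def relaxedClass (k : ℕ) (ψ : (Fin d → ℝ) → Fin q → ℝ) (b : Fin q → ℝ) :
    Set ((Fin d → ℝ) → ℝ) :=
  momentClass (uniformCube d) (stat k ψ) (statMean d k b)

lemma hAM_eq_neg_infDivergence (k : ℕ) (ψ : (Fin d → ℝ) → Fin q → ℝ) (b : Fin q → ℝ) :
    hAM k ψ b = -((infDivergence (uniformCube d) (relaxedClass k ψ b) : ℝ≥0∞) : EReal) :=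
  amind_eq_neg_infDivergence (stat k ψ) (statMean d k b)

lemma mem_relaxedClass_iff {k : ℕ} : g ∈ relaxedClass k ψ b ↔ IsDensity (uniformCube d) g ∧
    (∀ i, ∀ n < k, ∫ u, u i ^ (n + 1) ∂cubeLaw g = 1 / (1 + ((n + 1 : ℕ) : ℝ))) ∧
      expect (cubeLaw g) ψ = b := by
  refine and_congr_right fun hg => ?_
  simp only [← hg.integral_cubeLaw]
  refine ⟨fun h => ⟨fun i n hn => h (.inr (.inl (i, ⟨n, hn⟩))), funext fun j => h (.inr (.inr j))⟩,
    fun h => ?_⟩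
  have := hg.isCubeLaw.prob
  rintro (_ | ⟨i, n⟩ | j)
  · simp [stat, statMean]
  · exact h.1 i n n.2
  · exact congrFun h.2 j

lemma antitone_relaxedClass (ψ : (Fin d → ℝ) → Fin q → ℝ) (b : Fin q → ℝ) :
    Antitone fun k => relaxedClass k ψ b := fun k l hkl g hg => by
  rw [mem_relaxedClass_iff] at hg ⊢
  exact ⟨hg.1, fun i n hn => hg.2.1 i n (hn.trans_le hkl), hg.2.2⟩

lemma mem_iInter_relaxedClass_iff : g ∈ ⋂ k, relaxedClass k ψ b ↔
    IsDensity (uniformCube d) g ∧ IsCopulaLaw (cubeLaw g) ∧ expect (cubeLaw g) ψ = b := by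
  simp only [Set.mem_iInter, mem_relaxedClass_iff]
  refine ⟨fun h => ⟨(h 0).1, ?_, (h 0).2.2⟩, fun ⟨hg, hcop, hb⟩ k => ⟨hg, fun i n _ => ?_, hb⟩⟩
  · exact (h 0).1.isCubeLaw.isCopulaLaw_iff.2 fun i n => (h (n + 1)).2.1 i n n.lt_succ_self
  · exact hg.isCubeLaw.isCopulaLaw_iff.1 hcop i n

lemma hM_eq_neg_infDivergence (ψ : (Fin d → ℝ) → Fin q → ℝ) (b : Fin q → ℝ) :
    hM ψ b = -((infDivergence (uniformCube d) (⋂ k, relaxedClass k ψ b) : ℝ≥0∞) : EReal) := by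
  rw [← sSup_diffEntropy_cubeLaw fun g hg => (mem_iInter_relaxedClass_iff.1 hg).1, hM, mind]
  refine congrArg sSup (Set.ext fun h => ⟨?_, ?_⟩)
  · rintro ⟨P, hP, hb, rfl⟩
    obtain ⟨g, hg, rfl⟩ := hP.toIsCubeLaw.exists_density
    exact ⟨g, mem_iInter_relaxedClass_iff.2 ⟨hg, hP, hb⟩, rfl⟩
  · rintro ⟨g, hg, rfl⟩
    obtain ⟨-, hcop, hb⟩ := mem_iInter_relaxedClass_iff.1 hg
    exact ⟨cubeLaw g, hcop, hb, rfl⟩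

lemma memLp_top_uniformCube {f : (Fin d → ℝ) → ℝ} (hf : Measurable f) {C : ℝ}
    (hC : ∀ u ∈ cube d, |f u| ≤ C) : MemLp f ∞ (uniformCube d) :=
  memLp_top_of_bound hf.aestronglyMeasurable C (ae_mem_cube.mono hC)

lemma memLp_top_stat (hψ : ∀ j, MemLp (fun u => ψ u j) ∞ (uniformCube d)) (k : ℕ)
    (j : StatIndex d k q) : MemLp (fun u => stat k ψ u j) ∞ (uniformCube d) := by
  rcases j with _ | ⟨i, n⟩ | j
  · exact memLp_const 1
  · simp only [stat, Sum.elim_inr, Sum.elim_inl]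
    refine memLp_top_uniformCube ((measurable_pi_apply i).pow_const _) (C := 1) fun u hu => ?_
    rw [abs_of_nonneg (pow_nonneg (hu.1 i) _)]
    exact pow_le_one₀ (hu.1 i) (hu.2 i)
  · exact hψ j

lemma statMean_convexComb (k : ℕ) (x y : Fin q → ℝ) (s t : ℝ) (hst : s + t = 1) :
    statMean d k (s • x + t • y) = s • statMean d k x + t • statMean d k y := by
  funext j
  rcases j with _ | ⟨i, n⟩ | j
  · simp [statMean, hst]
  · simp only [statMean, Sum.elim_inr, Sum.elim_inl, Pi.add_apply, Pi.smul_apply, smul_eq_mul]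
    rw [← add_mul, hst, one_mul]
  · simp [statMean]

lemma isConvexFamily_relaxedClass (hψ : ∀ j, MemLp (fun u => ψ u j) ∞ (uniformCube d)) (k : ℕ) :
    IsConvexFamily (uniformCube d) (relaxedClass k ψ) :=
  (isConvexFamily_momentClass (memLp_top_stat hψ k)).comp (statMean_convexComb k)

lemma isL1Closed_relaxedClass (hψ : ∀ j, MemLp (fun u => ψ u j) ∞ (uniformCube d)) (k : ℕ)
    (b : Fin q → ℝ) : IsL1Closed (uniformCube d) (relaxedClass k ψ b) :=
  isL1Closed_momentClass (memLp_top_stat hψ k) _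

lemma continuous_statMean (k : ℕ) : Continuous (statMean d k : (Fin q → ℝ) → _) := by
  refine continuous_pi ?_
  rintro (_ | ⟨i, n⟩ | j)
  · exact continuous_const
  · exact continuous_const
  · exact continuous_apply j

end RelaxedClass

section Limits

variable {d q : ℕ} {ψ : (Fin d → ℝ) → Fin q → ℝ} {P : Measure (Fin d → ℝ)}

lemma IsCopulaLaw.expect_stat (hP : IsCopulaLaw P) (k : ℕ) (ψ : (Fin d → ℝ) → Fin q → ℝ) :
    expect P (stat k ψ) = statMean d k (expect P ψ) := by
  have := hP.prob
  funext j
  rcases j with _ | ⟨i, n⟩ | j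
  · simp [expect, stat, statMean]
  · exact hP.toIsCubeLaw.isCopulaLaw_iff.1 hP i n
  · rfl

lemma IsDensity.ae_cubeLaw_iff {p : (Fin d → ℝ) → ℝ} (hp : IsDensity (uniformCube d) p)
    {s : (Fin d → ℝ) → Prop} :
    (∀ᵐ u ∂cubeLaw p, s u) ↔ ∀ᵐ u ∂uniformCube d, 0 < p u → s u := by
  simp only [cubeLaw, ae_withDensity_iff' hp.aemeasurable_ofReal, ne_eq, ENNReal.ofReal_eq_zero,
    not_le]

lemma eventually_infDivergence_relaxedClass_ne_top
    (hψ : ∀ j, MemLp (fun u => ψ u j) ∞ (uniformCube d)) (hP : IsCopulaLaw P) {k : ℕ}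
    (hind : LinIndepAS P (stat k ψ)) :
    ∀ᶠ b in 𝓝 (expect P ψ), infDivergence (uniformCube d) (relaxedClass k ψ b) ≠ ∞ := by
  obtain ⟨p, hp, rfl⟩ := hP.toIsCubeLaw.exists_density
  have hmean : (fun j => ∫ u, p u * stat k ψ u j ∂uniformCube d) =
      statMean d k (expect (cubeLaw p) ψ) := by
    rw [← hP.expect_stat]
    exact funext fun j => (hp.integral_cubeLaw _).symm
  have hfin := eventually_infDivergence_momentClass_ne_top hp (memLp_top_stat hψ k)
    (j₀ := Sum.inl ()) (fun θ hθ => hind θ (hp.ae_cubeLaw_iff.2 hθ)) fun _ => rfl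
  rw [hmean] at hfin
  filter_upwards [(continuous_statMean k).continuousAt.eventually hfin] with b hb using hb rfl

theorem continuousAt_hAM (hψ : ∀ j, MemLp (fun u => ψ u j) ∞ (uniformCube d))
    (hP : IsCopulaLaw P) {k : ℕ} (hind : LinIndepAS P (stat k ψ)) :
    ContinuousAt (hAM k ψ) (expect P ψ) := by
  simp only [funext (hAM_eq_neg_infDivergence k ψ)]
  exact continuous_neg_coe_ennreal.continuousAt.comp
    ((isConvexFamily_relaxedClass hψ k).continuousAt_infDivergence
      (eventually_infDivergence_relaxedClass_ne_top hψ hP hind))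

theorem tendsto_hAM_hM (hψ : ∀ j, MemLp (fun u => ψ u j) ∞ (uniformCube d)) (b : Fin q → ℝ) :
    Tendsto (fun k => hAM k ψ b) atTop (𝓝 (hM ψ b)) := by
  simp only [hAM_eq_neg_infDivergence, hM_eq_neg_infDivergence]
  exact (continuous_neg_coe_ennreal.tendsto _).comp (tendsto_infDivergence_iInter
    (antitone_relaxedClass ψ b) (fun g hg => hg.1)
    (fun k => (isConvexFamily_relaxedClass hψ k).convex b) (isL1Closed_relaxedClass hψ · b))

lemma infDivergence_iInter_relaxedClass_ne_top {b : Fin q → ℝ} (hb : b ∈ copulaMeans ψ) :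
    infDivergence (uniformCube d) (⋂ k, relaxedClass k ψ b) ≠ ∞ := by
  obtain ⟨Q, hQ, hQ_ne_bot, rfl⟩ := hb
  have hM_ne_bot : hM ψ (expect Q ψ) ≠ ⊥ :=
    ne_bot_of_le_ne_bot hQ_ne_bot (le_sSup ⟨Q, hQ, rfl, rfl⟩)
  intro htop
  exact hM_ne_bot (by rw [hM_eq_neg_infDivergence, htop, EReal.coe_ennreal_top, EReal.neg_top])

theorem tendsto_hAM_prod_nhds (hψ : ∀ j, MemLp (fun u => ψ u j) ∞ (uniformCube d))
    {b : Fin q → ℝ} (hb : b ∈ interior (copulaMeans ψ)) :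
    Tendsto (fun p : ℕ × (Fin q → ℝ) => hAM p.1 ψ p.2) (atTop ×ˢ 𝓝 b) (𝓝 (hM ψ b)) := by
  have hfin : ∀ᶠ b in 𝓝 b, infDivergence (uniformCube d) (⋂ k, relaxedClass k ψ b) ≠ ∞ :=
    eventually_of_mem (mem_interior_iff_mem_nhds.1 hb) fun _ =>
      infDivergence_iInter_relaxedClass_ne_top
  have hlim := tendsto_infDivergence_prod_nhds (isConvexFamily_relaxedClass hψ)
    (isL1Closed_relaxedClass hψ) (antitone_relaxedClass ψ) hfin
  simp only [hAM_eq_neg_infDivergence, hM_eq_neg_infDivergence]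
  exact (continuous_neg_coe_ennreal.tendsto _).comp hlim

theorem tendsto_hAM_diffEntropy {q : ℕ → ℕ} {ψ : (m : ℕ) → (Fin d → ℝ) → Fin (q m) → ℝ}
    (hψ : ∀ m j, MemLp (fun u => ψ m u j) ∞ (uniformCube d)) (hP : IsCopulaLaw P) {k : ℕ}
    (huniv : UniversalApproximator fun m => stat k (ψ m)) :
    Tendsto (fun m => hAM k (ψ m) (expect P (ψ m))) atTop (𝓝 (diffEntropy P)) := by
  obtain ⟨p, hp, rfl⟩ := hP.toIsCubeLaw.exists_density
  have happrox : ∀ f : (Fin d → ℝ) → ℝ, Continuous f → ∀ ε > 0, ∀ᶠ m in atTop,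
      ∃ θ : StatIndex d k (q m) → ℝ, ∀ᵐ u ∂uniformCube d,
        |f u - ∑ j, θ j * stat k (ψ m) u j| ≤ ε := fun f hf ε hε =>
    (huniv f hf.continuousOn ε hε).mono fun m ⟨θ, hθ⟩ =>
      ⟨θ, ae_mem_cube.mono fun u hu => (hθ u hu).le⟩
  have hlim := (continuous_neg_coe_ennreal.tendsto _).comp
    (tendsto_infDivergence_momentClass_of_approx (fun m => memLp_top_stat (hψ m) k) happrox hp)
  simp only [← hp.integral_cubeLaw] at hlim
  rw [hp.diffEntropy_cubeLaw]
  refine hlim.congr fun m => ?_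
  rw [hAM_eq_neg_infDivergence, relaxedClass, ← hP.expect_stat]
  rfl

end Limits

section InProbability

variable {Ω : Type*} [MeasurableSpace Ω] {μ : Measure Ω}

lemma tendstoInProb_of_tendstoInMeasure {E ι : Type*} [PseudoEMetricSpace E] {l : Filter ι}
    {X : ι → Ω → E} {a : E} (h : TendstoInMeasure μ X l fun _ => a) : TendstoInProb μ X l a := by
  intro U hU
  obtain ⟨ε, hε, hsub⟩ := EMetric.mem_nhds_iff.1 hU
  refine tendsto_of_tendsto_of_tendsto_of_le_of_le tendsto_const_nhds (h ε hε)
    (fun _ => zero_le) fun i => measure_mono fun ω hω => ?_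
  by_contra hlt
  exact hω (hsub (Metric.mem_eball.2 (not_le.1 hlt)))

variable {E : Type*} [TopologicalSpace E]

lemma TendstoInProb.comp_prod {E' ι κ : Type*} [TopologicalSpace E'] {l : Filter ι} {l' : Filter κ}
    {X : κ → Ω → E} {a : E} {b : E'} {F : ι → E → E'} (hX : TendstoInProb μ X l' a)
    (hF : Tendsto (fun p : ι × E => F p.1 p.2) (l ×ˢ 𝓝 a) (𝓝 b)) :
    TendstoInProb μ (fun (p : ι × κ) ω => F p.1 (X p.2 ω)) (l ×ˢ l') b := by
  intro U hU
  obtain ⟨A, hA, B, hB, hAB⟩ := Filter.mem_prod_iff.1 (hF hU)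
  refine tendsto_of_tendsto_of_tendsto_of_le_of_le' tendsto_const_nhds
    ((hX B hB).comp tendsto_snd) (Eventually.of_forall fun _ => zero_le) ?_
  filter_upwards [tendsto_fst.eventually hA] with p hp
  exact measure_mono fun ω hω hωB => hω (hAB (Set.mk_mem_prod hp hωB))

lemma TendstoInProb.comp_continuousAt {E' κ : Type*} [TopologicalSpace E'] {l : Filter κ}
    {X : κ → Ω → E} {a : E} {F : E → E'} (hX : TendstoInProb μ X l a) (hF : ContinuousAt F a) :
    TendstoInProb μ (fun i ω => F (X i ω)) l (F a) :=
  fun _ hU => hX _ (hF hU)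

lemma exists_forall_eventually_jointly {Q : ℕ → ℕ → ℕ → Prop}
    (hQ : ∀ j, ∀ᶠ r in atTop, ∀ᶠ n in atTop, Q j r n) :
    ∃ N : ℕ → ℕ, ∀ j, ∀ᶠ p in jointly N, Q j p.1 p.2 := by
  have hN : ∀ r, ∃ N, ∀ n ≥ N, ∀ j ≤ r, (∀ᶠ n in atTop, Q j r n) → Q j r n := fun r => by
    refine eventually_atTop.1 ((eventually_all_finite (Set.finite_Iic r)).2 fun j _ => ?_)
    by_cases hj : ∀ᶠ n in atTop, Q j r n
    · exact hj.mono fun n hn _ => hn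
    · exact Eventually.of_forall fun n h => absurd h hj
  choose N hN using hN
  refine ⟨N, fun j => ?_⟩
  have hfst : Tendsto Prod.fst (jointly N) atTop := tendsto_fst.mono_left inf_le_left
  have hge : ∀ᶠ p : ℕ × ℕ in jointly N, N p.1 ≤ p.2 := mem_inf_of_right (mem_principal_self _)
  filter_upwards [hge, hfst.eventually (hQ j), hfst.eventually (eventually_ge_atTop j)]
    with p hp hQp hjp using hN p.1 p.2 hp j hjp hQp

theorem exists_tendstoInProb_jointly [FirstCountableTopology E] {X : ℕ → ℕ → Ω → E} {v : ℕ → E}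
    {a : E} (hX : ∀ᶠ r in atTop, TendstoInProb μ (X r) atTop (v r))
    (hv : Tendsto v atTop (𝓝 a)) :
    ∃ N : ℕ → ℕ, TendstoInProb μ (fun p ω => X p.1 p.2 ω) (jointly N) a := by
  obtain ⟨U, hU⟩ := (𝓝 a).exists_antitone_basis
  have hsmall : ∀ j : ℕ, ∀ᶠ r in atTop, ∀ᶠ n in atTop,
      μ {ω | X r n ω ∉ U j} ≤ (j : ℝ≥0∞)⁻¹ := fun j => by
    filter_upwards [hX, hv (interior_mem_nhds.2 (hU.mem j))] with r hXr hvr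
    exact ENNReal.tendsto_nhds_zero.1 (hXr (U j) (mem_interior_iff_mem_nhds.1 hvr)) _ (by simp)
  obtain ⟨N, hN⟩ := exists_forall_eventually_jointly hsmall
  refine ⟨N, fun W hW => ENNReal.tendsto_nhds_zero.2 fun ε hε => ?_⟩
  obtain ⟨j, hjW, hjε⟩ := ((hU.eventually_subset hW).and
    (ENNReal.tendsto_nhds_zero.1 ENNReal.tendsto_inv_nat_nhds_zero ε hε)).exists
  filter_upwards [hN j] with p hp
  refine (measure_mono ?_).trans (hp.trans hjε)
  exact fun ω hω h => hω (hjW h)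

end InProbability

section Consistency

variable {Ω : Type*} [MeasurableSpace Ω] {μ : Measure Ω} {d : ℕ} {P : Measure (Fin d → ℝ)}

section FixedStatistic

variable {q : ℕ} {ψ : (Fin d → ℝ) → Fin q → ℝ}

theorem tendstoInProb_hAM (hψ : ∀ j, MemLp (fun u => ψ u j) ∞ (uniformCube d))
    (hP : IsCopulaLaw P) {k : ℕ} (hind : LinIndepAS P (stat k ψ)) {ι : Type*} {l : Filter ι}
    {X : ι → Ω → Fin q → ℝ} (hX : TendstoInMeasure μ X l fun _ => expect P ψ) :
    TendstoInProb μ (fun n ω => hAM k ψ (X n ω)) l (hAM k ψ (expect P ψ)) :=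
  (tendstoInProb_of_tendstoInMeasure hX).comp_continuousAt (continuousAt_hAM hψ hP hind)

theorem exists_tendstoInProb_jointly_hAM_hM
    (hψ : ∀ j, MemLp (fun u => ψ u j) ∞ (uniformCube d)) (hP : IsCopulaLaw P)
    (hind : ∀ᶠ k in atTop, LinIndepAS P (stat k ψ)) {X : ℕ → Ω → Fin q → ℝ}
    (hX : TendstoInMeasure μ X atTop fun _ => expect P ψ) :
    ∃ N : ℕ → ℕ, TendstoInProb μ (fun p ω => hAM p.1 ψ (X p.2 ω)) (jointly N)
      (hM ψ (expect P ψ)) :=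
  exists_tendstoInProb_jointly (X := fun k n ω => hAM k ψ (X n ω))
    (hind.mono fun _ hk => tendstoInProb_hAM hψ hP hk hX) (tendsto_hAM_hM hψ _)

theorem tendstoInProb_prod_hAM_hM (hψ : ∀ j, MemLp (fun u => ψ u j) ∞ (uniformCube d))
    {ι : Type*} {l : Filter ι} {X : ι → Ω → Fin q → ℝ} {b : Fin q → ℝ}
    (hX : TendstoInMeasure μ X l fun _ => b) (hb : b ∈ interior (copulaMeans ψ)) :
    TendstoInProb μ (fun p ω => hAM p.1 ψ (X p.2 ω)) (atTop ×ˢ l) (hM ψ b) :=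
  (tendstoInProb_of_tendstoInMeasure hX).comp_prod (F := fun k b => hAM k ψ b)
    (tendsto_hAM_prod_nhds hψ hb)

end FixedStatistic

theorem exists_tendstoInProb_jointly_hAM_diffEntropy {q : ℕ → ℕ}
    {ψ : (m : ℕ) → (Fin d → ℝ) → Fin (q m) → ℝ}
    (hψ : ∀ m j, MemLp (fun u => ψ m u j) ∞ (uniformCube d)) (hP : IsCopulaLaw P) {k : ℕ}
    (hind : ∀ᶠ m in atTop, LinIndepAS P (stat k (ψ m)))
    (huniv : UniversalApproximator fun m => stat k (ψ m))
    {X : (m : ℕ) → ℕ → Ω → Fin (q m) → ℝ}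
    (hX : ∀ m, TendstoInMeasure μ (X m) atTop fun _ => expect P (ψ m)) :
    ∃ N : ℕ → ℕ, TendstoInProb μ (fun p ω => hAM k (ψ p.1) (X p.1 p.2 ω)) (jointly N)
      (diffEntropy P) :=
  exists_tendstoInProb_jointly (X := fun m n ω => hAM k (ψ m) (X m n ω))
    (hind.mono fun m hm => tendstoInProb_hAM (hψ m) hP hm (hX m))
    (tendsto_hAM_diffEntropy hψ hP huniv)

end Consistency

end MaxEntCopula

end

theorem mainTheorem3 {Ω : Type*} [MeasurableSpace Ω] (μ : Measure Ω) [IsProbabilityMeasure μ]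
    (d : ℕ) (z : Ω → Fin d → ℝ) (hz : Measurable z)
    -- `Pu` is the law of the copula-uniform dual representation of `z`; it has a pdf
    (Pu : Measure (Fin d → ℝ)) (hPu : Pu = μ.map (MaxEntCopula.dualRep μ z))
    (hpdf : Pu ≪ volume)
    -- the statistics functions
    (q : ℕ → ℕ) (ψ : (m : ℕ) → (Fin d → ℝ) → Fin (q m) → ℝ)
    (hψ : ∀ m, Measurable (ψ m))
    (hψb : ∀ m, ∃ C : ℝ, ∀ u ∈ MaxEntCopula.cube d, ∀ j, |ψ m u j| ≤ C)
    -- their expectations and consistent estimators of them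
    (β : (m : ℕ) → Fin (q m) → ℝ) (hβ : ∀ m, β m = MaxEntCopula.expect Pu (ψ m))
    (βhat : (m : ℕ) → ℕ → Ω → Fin (q m) → ℝ)
    (hβhat : ∀ m, TendstoInMeasure μ (βhat m) atTop (fun _ => β m)) :
    -- (A)
    (∀ m : ℕ, (∀ k : ℕ, 0 < k → MaxEntCopula.LinIndepAS Pu (MaxEntCopula.stat k (ψ m))) →
      (∀ k : ℕ, 0 < k →
        MaxEntCopula.TendstoInProb μ (fun n ω => MaxEntCopula.hAM k (ψ m) (βhat m n ω)) atTop
          (MaxEntCopula.hAM k (ψ m) (β m))) ∧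
      Tendsto (fun k => MaxEntCopula.hAM k (ψ m) (β m)) atTop
        (𝓝 (MaxEntCopula.hM (ψ m) (β m))) ∧
      (∃ N : ℕ → ℕ, MaxEntCopula.TendstoInProb μ
        (fun p ω => MaxEntCopula.hAM p.1 (ψ m) (βhat m p.2 ω)) (MaxEntCopula.jointly N)
        (MaxEntCopula.hM (ψ m) (β m))) ∧
      (β m ∈ interior (MaxEntCopula.copulaMeans (ψ m)) → MaxEntCopula.TendstoInProb μ
        (fun p ω => MaxEntCopula.hAM p.1 (ψ m) (βhat m p.2 ω))
        ((atTop : Filter ℕ) ×ˢ (atTop : Filter ℕ)) (MaxEntCopula.hM (ψ m) (β m)))) ∧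
    -- (B)
    (∀ k : ℕ, 0 < k → (∀ m, MaxEntCopula.LinIndepAS Pu (MaxEntCopula.stat k (ψ m))) →
      MaxEntCopula.UniversalApproximator (fun m => MaxEntCopula.stat k (ψ m)) →
      (∀ m : ℕ,
        MaxEntCopula.TendstoInProb μ (fun n ω => MaxEntCopula.hAM k (ψ m) (βhat m n ω)) atTop
          (MaxEntCopula.hAM k (ψ m) (β m))) ∧
      Tendsto (fun m => MaxEntCopula.hAM k (ψ m) (β m)) atTop
        (𝓝 (MaxEntCopula.diffEntropy Pu)) ∧
      ∃ N : ℕ → ℕ, MaxEntCopula.TendstoInProb μ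
        (fun p ω => MaxEntCopula.hAM k (ψ p.1) (βhat p.1 p.2 ω)) (MaxEntCopula.jointly N)
        (MaxEntCopula.diffEntropy Pu)) := by
  have hP : MaxEntCopula.IsCopulaLaw Pu := by
    rw [hPu] at hpdf ⊢
    exact MaxEntCopula.isCopulaLaw_dualRep hz hpdf
  obtain rfl : β = fun m => MaxEntCopula.expect Pu (ψ m) := funext hβ
  have hψ_top : ∀ m j, MemLp (fun u => ψ m u j) ∞ (MaxEntCopula.uniformCube d) := fun m j =>
    MaxEntCopula.memLp_top_uniformCube ((measurable_pi_apply j).comp (hψ m))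
      fun u hu => (hψb m).choose_spec u hu j
  refine ⟨fun m hind => ⟨fun k hk => ?_, ?_, ?_, fun hint => ?_⟩,
    fun k _ hind huniv => ⟨fun m => ?_, ?_, ?_⟩⟩
  · exact MaxEntCopula.tendstoInProb_hAM (hψ_top m) hP (hind k hk) (hβhat m)
  · exact MaxEntCopula.tendsto_hAM_hM (hψ_top m) _
  · exact MaxEntCopula.exists_tendstoInProb_jointly_hAM_hM (hψ_top m) hP
      ((eventually_gt_atTop 0).mono hind) (hβhat m)
  · exact MaxEntCopula.tendstoInProb_prod_hAM_hM (hψ_top m) (hβhat m) hint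
  · exact MaxEntCopula.tendstoInProb_hAM (hψ_top m) hP (hind m) (hβhat m)
  · exact MaxEntCopula.tendsto_hAM_diffEntropy hψ_top hP huniv
  · exact MaxEntCopula.exists_tendstoInProb_jointly_hAM_diffEntropy hψ_top hP
      (Eventually.of_forall hind) huniv hβhat
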